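/- **Setting.** Let $\theta^\star\in\mathbb R^d$. Playing an action $a$ yields the reward $\langle a,\theta^\star\rangle+\xi$, where the noise variables $\xi$ of different plays are independent, $1$-sub-Gaussian, and independent of the internal randomness of the procedure. Norms are Euclidean. For $h\in\mathbb R^d$ let $P_h^\perp$ be the orthogonal projection onto $h^\perp$ ($P_0^\perp=I$), and $d'=d-\mathbf 1[h\neq0]$. **$\textsc{EstimateNorm}(h,\Delta)$.** Sample once $p=\frac{\Delta}{\sqrt{d'}}P_h^\perp g$ with $g\sim\mathcal N(0,I_d)$. In its $n$-th call, $\textsc{PlayAndUpdate}$ plays $h$ (reward $y_n$) and $\frac{h+p}{\sqrt{\|p\|^2+\|h\|^2}}$ (reward $z_n$), and computes the averages $\bar y_n,\bar z_n$ of all these rewards so far, $\bar x_n=\sqrt{\|p\|^2+\|h\|^2}\,\bar z_n-\bar y_n$ and $b_n=\sqrt{3(1+\|h\|^2+\|p\|^2)\ln(40\ln(2n))/n}$. If $|\bar x_n|\ge 2b_n$, it returns $\frac{\sqrt{d'}}{\Delta}|\bar x_n|$. **$\textsc{EstimateNormHP}(h,\Delta,\delta)$.** Start $k=\lceil 560\ln(1/\delta)\rceil$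 independent instances $C_1,\dots,C_k$ of $\textsc{EstimateNorm}(h,\Delta)$, all active, and an empty collection $R$. A call of $\textsc{PlayAndUpdate}$ of $\textsc{EstimateNormHP}$ calls $\textsc{PlayAndUpdate}$ of every active $C_i$ once (if $|R|\ge0.67k$ already, it only plays $h$); the instances that return a value become inactive and their values are added to $R$. If then $|R|\ge 0.67k$, it returns the median of $R$. **Lemma.** There is an absolute constant $C>0$ such that the following holds for all $d$, $h,\theta^\star\in\mathbb R^d$ with $P_h^\perp\theta^\star\ne0$, $\Delta>0$ and $\delta\in(0,1)$. Put $$X=\frac{d(1+\Delta^2+\|h\|^2)}{\Delta^2\|P_h^\perp\theta^\star\|^2},\qquad \ell=\ln\bigl(e+\ln(1+X)\bigr),\qquad L=\max\{1,\ln(1/\delta)\}.$$ With probability at least $1-\delta$, $\textsc{EstimateNormHP}(h,\Delta,\delta)$ returns a value $r$, and, if $n$ is the number of calls of its $\textsc{PlayAndUpdate}$ procedure until then and $M$ is the total number of calls of $\textsc{PlayAndUpdate}$ of all the instances $C_1,\dots,C_k$ until then, all of the following hold. 1. $0.06\,\|P_h^\perp\theta^\star\|\le r\le5\,\|P_h^\perp\theta^\star\|$.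 2. $n\le 1+C\,X\,\ell$. 3. If $\Delta\le1/224$ and $\|h\|=1$, the regret with respect to $h$, $\sum_a\langle\theta^\star,h-a\rangle$ over all actions $a$ played until the return, is at most $$C\Bigl(M\|\theta^\star\|\Delta^2+M\frac{\Delta\|P_h^\perp\theta^\star\|}{\sqrt d}\Bigr),$$ and if $X\ge1$, then $$M\|\theta^\star\|\Delta^2+M\frac{\Delta\|P_h^\perp\theta^\star\|}{\sqrt d}\le C\,\ell\,L\Bigl(\frac{d\|\theta^\star\|}{\|P_h^\perp\theta^\star\|^2}+\frac{\sqrt d}{\Delta\|P_h^\perp\theta^\star\|}\Bigr).$$ 4. If $\Delta\le1/224$, $\langle h,\theta^\star\rangle\ge-\|\theta^\star\|/4$, and $\|h\|=1$ or $h=0$, the total regret $\sum_a\langle\theta^\star,\theta^\star/\|\theta^\star\|-a\rangle$ over all actions $a$ played until the return is at most $$C\Bigl(M\frac{\|P_h^\perp\theta^\star\|^2}{\|\theta^\star\|}+M\|\theta^\star\|\Delta^2\Bigr),$$ and if $X\ge1$, then $$M\frac{\|P_h^\perp\theta^\star\|^2}{\|\theta^\star\|}+M\|\theta^\star\|\Delta^2\le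 C\,\ell\,L\Bigl(\frac{d(1+\|h\|)}{\Delta^2\|\theta^\star\|}+\frac{d(1+\|h\|)\|\theta^\star\|}{\|P_h^\perp\theta^\star\|^2}\Bigr).$$ -/

import Mathlib

open MeasureTheory ProbabilityTheory
open scoped RealInnerProductSpace

noncomputable section

namespace HintBandit

/-- The Euclidean space `ℝ^d` of actions and parameters. -/
abbrev E (d : ℕ) : Type := EuclideanSpace ℝ (Fin d)

/-- `P_h^⊥ u`, the orthogonal projection of `u` onto the complement of the line spanned by `h`
(so `P_0^⊥ u = u`). -/
def perp {d : ℕ} (h u : E d) : E d := (Submodule.span ℝ {h})ᗮ.starProjection u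

/-- `d' = d - 1[h ≠ 0]`. -/
def effDim {d : ℕ} (h : E d) : ℕ := if h = 0 then d else d - 1

/-- The projected Gaussian law `N_h(0, Δ² / d')`: the law of `(Δ / √d') P_h^⊥ g` for a standard
Gaussian vector `g` of `ℝ^d`. -/
def perturbLaw {d : ℕ} (h : E d) (Δ : ℝ) : Measure (E d) :=
  (stdGaussian (E d)).map (fun g => (Δ / √(effDim h : ℝ)) • perp h g)

/-! ### One instance `EstimateNorm(h, Δ)` with perturbation `p`

The noise of the `(j+1)`-st play of the hint is `ξ j false`, the noise of the `(j+1)`-st play of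
the perturbed hint is `ξ j true`. -/

/-- The perturbed action `(h + p) / √(‖p‖² + ‖h‖²)`. -/
def perturbedAction {d : ℕ} (h p : E d) : E d := (1 / √(‖p‖ ^ 2 + ‖h‖ ^ 2)) • (h + p)

/-- The average of the rewards `⟨a, θ⟩ + ζ j` of the first `n` plays of the action `a`. -/
def avgReward {d : ℕ} (θ a : E d) (ζ : ℕ → ℝ) (n : ℕ) : ℝ :=
  (∑ j ∈ Finset.range n, (⟪a, θ⟫ + ζ j)) / n

/-- The average difference `x̄_n = z̄_n √(‖p‖² + ‖h‖²) - ȳ_n` after `n` calls. -/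
def avgDiff {d : ℕ} (θ h p : E d) (ξ : ℕ → Bool → ℝ) (n : ℕ) : ℝ :=
  avgReward θ (perturbedAction h p) (fun j => ξ j true) n * √(‖p‖ ^ 2 + ‖h‖ ^ 2)
    - avgReward θ h (fun j => ξ j false) n

/-- The confidence width `b_n`. -/
def width {d : ℕ} (h p : E d) (n : ℕ) : ℝ :=
  √(3 * (1 + ‖h‖ ^ 2 + ‖p‖ ^ 2) * Real.log (40 * Real.log (2 * n)) / n)

/-- The test `|x̄_n| ≥ 2 b_n`, which makes the `n`-th call of `PlayAndUpdate` return a value. -/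
def instReturns {d : ℕ} (θ h p : E d) (ξ : ℕ → Bool → ℝ) (n : ℕ) : Prop :=
  2 * width h p n ≤ |avgDiff θ h p ξ n|

/-- The value `(√d' / Δ) |x̄_n|` that is returned if the test succeeds at the `n`-th call. -/
def instValue {d : ℕ} (θ h : E d) (Δ : ℝ) (p : E d) (ξ : ℕ → Bool → ℝ) (n : ℕ) : ℝ :=
  √(effDim h : ℝ) / Δ * |avgDiff θ h p ξ n|

/-! ### The procedure `EstimateNormHP(h, Δ, δ)` -/

/-- The number `k = ⌈560 ln(1/δ)⌉` of instances. -/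
def numInstances (δ : ℝ) : ℕ := ⌈560 * Real.log (1 / δ)⌉₊

/-- The median of a finite multiset of reals (the mean of the two middle entries if the
cardinality is even). -/
def median (R : Multiset ℝ) : ℝ :=
  let l := R.sort
  (l.getD ((l.length - 1) / 2) 0 + l.getD (l.length / 2) 0) / 2

/-- State of the procedure: the set `S` of active instances, the number of calls made so far to
`PlayAndUpdate` of each instance, the collection `R` of returned values, and the collection of all
actions played so far (with multiplicity). -/
structure State (d k : ℕ) where
  active : Finset (Fin k)
  calls : Fin k → ℕ
  returned : Multiset ℝ
  played : Multiset (E d)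

/-- The initial state. -/
def State.init (d k : ℕ) : State d k := ⟨Finset.univ, fun _ => 0, 0, 0⟩

/-- `|R| ≥ 0.67 k`. -/
def State.Done {d k : ℕ} (s : State d k) : Prop := 0.67 * (k : ℝ) ≤ (s.returned.card : ℝ)

open Classical in
/-- One call of `PlayAndUpdate` of the high-probability procedure. If `|R| ≥ 0.67 k`, only the hint
is played. Otherwise every active instance `i` makes its next call, in which it plays the hint and
its own perturbed hint; the instances that return a value leave the active set and their values are
added to `R`. -/
def State.step {d k : ℕ} (θ h : E d) (Δ : ℝ) (p : Fin k → E d) (ξ : Fin k × ℕ × Bool → ℝ)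
    (s : State d k) : State d k :=
  if s.Done then
    { s with played := s.played + {h} }
  else
    let ret : Finset (Fin k) :=
      s.active.filter fun i => instReturns θ h (p i) (fun j b => ξ (i, j, b)) (s.calls i + 1)
    { active := s.active \ ret
      calls := fun i => if i ∈ s.active then s.calls i + 1 else s.calls i
      returned := s.returned +
        ret.val.map fun i => instValue θ h Δ (p i) (fun j b => ξ (i, j, b)) (s.calls i + 1)
      played := s.played + s.active.val.bind fun i => {h, perturbedAction h (p i)} }

/-- The state after `n` calls of `PlayAndUpdate`. -/
def run {d k : ℕ} (θ h : E d) (Δ : ℝ) (p : Fin k → E d) (ξ : Fin k × ℕ × Bool → ℝ) (n : ℕ) :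
    State d k :=
  (State.step θ h Δ p ξ)^[n] (State.init d k)

/-- The `n`-th call of `PlayAndUpdate` is the first one that returns a value. That value is the
median of `R` at that moment. -/
def FirstReturn {d k : ℕ} (θ h : E d) (Δ : ℝ) (p : Fin k → E d) (ξ : Fin k × ℕ × Bool → ℝ)
    (n : ℕ) : Prop :=
  1 ≤ n ∧ (run θ h Δ p ξ n).Done ∧ ∀ m, 1 ≤ m → m < n → ¬ (run θ h Δ p ξ m).Done

/-- Total number of calls of `PlayAndUpdate` of all the instances `C_i`. -/
def State.innerCalls {d k : ℕ} (s : State d k) : ℕ := ∑ i, s.calls i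

/-- The regret `∑ ⟨θ, b - a⟩` with respect to the action `b`, over all actions `a` played. -/
def State.regret {d k : ℕ} (θ b : E d) (s : State d k) : ℝ :=
  (s.played.map fun a => ⟪θ, b - a⟫).sum

/-! ### The quantities in the bounds -/

/-- `X = d (1 + Δ² + ‖h‖²) / (Δ² ‖P_h^⊥ θ‖²)`. -/
def scale {d : ℕ} (θ h : E d) (Δ : ℝ) : ℝ :=
  d * (1 + Δ ^ 2 + ‖h‖ ^ 2) / (Δ ^ 2 * ‖perp h θ‖ ^ 2)

/-- The logarithmic factor hidden in `Õ`: `ln(e + ln(1 + X))`. -/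
def logFactor (X : ℝ) : ℝ := Real.log (Real.exp 1 + Real.log (1 + X))

end HintBandit

end

namespace HintBandit

/-! ### Medians -/

theorem succ_le_countP_of_sorted {l : List ℝ} (hl : l.Pairwise (· ≤ ·)) (P : ℝ → Bool) {a : ℝ}
    (hP : ∀ x, x < a → P x = true) {i : ℕ} (hi : i < l.length) (hia : l[i] < a) :
    i + 1 ≤ l.countP P := by
  have h1 : (l.take (i + 1)).countP P = (l.take (i + 1)).length := by
    rw [List.countP_eq_length]
    intro x hx
    obtain ⟨j, hj, rfl⟩ := List.getElem_of_mem hx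
    rw [List.length_take] at hj
    rw [List.getElem_take]
    exact hP _ ((hl.rel_get_of_le (a := ⟨j, by omega⟩) (b := ⟨i, hi⟩)
      (by simp only [Fin.mk_le_mk]; omega)).trans_lt hia)
  have h2 := (List.take_sublist (i + 1) l).countP_le (p := P)
  rw [h1, List.length_take] at h2
  omega

theorem sub_le_countP_of_sorted {l : List ℝ} (hl : l.Pairwise (· ≤ ·)) (P : ℝ → Bool) {b : ℝ}
    (hP : ∀ x, b < x → P x = true) {i : ℕ} (hi : i < l.length) (hib : b < l[i]) :
    l.length - i ≤ l.countP P := by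
  have h1 : (l.drop i).countP P = (l.drop i).length := by
    rw [List.countP_eq_length]
    intro x hx
    obtain ⟨j, hj, rfl⟩ := List.getElem_of_mem hx
    rw [List.length_drop] at hj
    rw [List.getElem_drop]
    exact hP _ (hib.trans_le (hl.rel_get_of_le (a := ⟨i, hi⟩) (b := ⟨i + j, by omega⟩)
      (by simp only [Fin.mk_le_mk]; omega)))
  have h2 := (List.drop_sublist i l).countP_le (p := P)
  rw [h1, List.length_drop] at h2
  exact h2

/-- If fewer than half of the entries of a multiset lie outside of `[a, b]`, then its median lies
in `[a, b]`. -/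
theorem median_mem_Icc (R : Multiset ℝ) (a b : ℝ)
    (h : 2 * R.countP (fun x => ¬ (a ≤ x ∧ x ≤ b)) < R.card) :
    a ≤ median R ∧ median R ≤ b := by
  set l := R.sort with hl
  have hlen : l.length = R.card := by simp [hl]
  have hs : l.Pairwise (· ≤ ·) := Multiset.pairwise_sort R (· ≤ ·)
  have hc : l.countP (fun x => decide ¬ (a ≤ x ∧ x ≤ b))
      = R.countP (fun x => ¬ (a ≤ x ∧ x ≤ b)) := by
    conv_rhs => rw [← Multiset.sort_eq R (· ≤ ·)]
    rw [Multiset.coe_countP]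
  have key : ∀ i, (hi : i < l.length) → l.length ≤ 2 * (i + 1) → i ≤ l.length / 2 →
      a ≤ l[i] ∧ l[i] ≤ b := by
    intro i hi h1 h2
    constructor
    · by_contra! hlt
      have := succ_le_countP_of_sorted hs (fun x => decide ¬ (a ≤ x ∧ x ≤ b))
        (fun x hx => by simp [hx]) hi hlt
      omega
    · by_contra! hlt
      have := sub_le_countP_of_sorted hs (fun x => decide ¬ (a ≤ x ∧ x ≤ b))
        (fun x hx => by simp [hx]) hi hlt
      omega
  have h1 := key ((l.length - 1) / 2) (by omega) (by omega) (by omega)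
  have h2 := key (l.length / 2) (by omega) (by omega) (by omega)
  have hm : median R = (l[(l.length - 1) / 2]'(by omega) + l[l.length / 2]'(by omega)) / 2 := by
    simp only [median, ← hl]
    rw [List.getD_eq_getElem _ _ (by omega), List.getD_eq_getElem _ _ (by omega)]
  rw [hm]
  constructor <;> linarith [h1.1, h1.2, h2.1, h2.2]

/-! ### Invariants of the procedure -/

variable {d k : ℕ} (θ h : E d) (Δ : ℝ) (p : Fin k → E d) (ξ : Fin k × ℕ × Bool → ℝ)

/-- What holds after `n` calls as long as the procedure has not returned. -/
structure Invariant (s : State d k) (n : ℕ) : Prop where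
  calls_of_active : ∀ i ∈ s.active, s.calls i = n
  not_returns : ∀ i ∈ s.active, ∀ m, 1 ≤ m → m ≤ n →
    ¬ instReturns θ h (p i) (fun j b => ξ (i, j, b)) m
  calls_le : ∀ i, s.calls i ≤ n
  returns : ∀ i, i ∉ s.active → 1 ≤ s.calls i ∧
    instReturns θ h (p i) (fun j b => ξ (i, j, b)) (s.calls i)
  returned_eq : s.returned = s.activeᶜ.val.map
    fun i => instValue θ h Δ (p i) (fun j b => ξ (i, j, b)) (s.calls i)
  played_eq : s.played = ∑ i, s.calls i • ({h, perturbedAction h (p i)} : Multiset (E d))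

theorem invariant_init : Invariant θ h Δ p ξ (State.init d k) 0 where
  calls_of_active := by simp [State.init]
  not_returns := by intro i _ m h1 h2; omega
  calls_le := by simp [State.init]
  returns := by simp [State.init]
  returned_eq := by simp [State.init]
  played_eq := by simp [State.init]

theorem Invariant.step {s : State d k} {n : ℕ} (hs : Invariant θ h Δ p ξ s n) (hd : ¬ s.Done) :
    Invariant θ h Δ p ξ (s.step θ h Δ p ξ) (n + 1) ∧
      ∀ i ∈ s.active, (s.step θ h Δ p ξ).calls i = n + 1 := by
  classical
  set ret : Finset (Fin k) :=
    s.active.filter fun i => instReturns θ h (p i) (fun j b => ξ (i, j, b)) (s.calls i + 1)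
    with hret
  have hstep : s.step θ h Δ p ξ =
    { active := s.active \ ret
      calls := fun i => if i ∈ s.active then s.calls i + 1 else s.calls i
      returned := s.returned +
        ret.val.map fun i => instValue θ h Δ (p i) (fun j b => ξ (i, j, b)) (s.calls i + 1)
      played := s.played + s.active.val.bind fun i => {h, perturbedAction h (p i)} } := by
    rw [State.step, if_neg hd, hret]
  rw [hstep]
  have hsub : ret ⊆ s.active := Finset.filter_subset _ _
  refine ⟨⟨?_, ?_, ?_, ?_, ?_, ?_⟩, ?_⟩
  · intro i hi
    have hi' := (Finset.mem_sdiff.1 hi).1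
    simp [hi', hs.calls_of_active i hi']
  · intro i hi m h1 h2
    obtain ⟨hi', hr⟩ := Finset.mem_sdiff.1 hi
    rcases Nat.lt_or_ge n m with hm | hm
    · obtain rfl : m = n + 1 := by omega
      intro hc
      exact hr (Finset.mem_filter.2 ⟨hi', by rwa [hs.calls_of_active i hi']⟩)
    · exact hs.not_returns i hi' m h1 hm
  · intro i
    have := hs.calls_le i
    dsimp only
    split_ifs <;> omega
  · intro i hi
    dsimp only at hi ⊢
    by_cases hi' : i ∈ s.active
    · have hr : i ∈ ret := by
        by_contra hr
        exact hi (Finset.mem_sdiff.2 ⟨hi', hr⟩)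
      rw [if_pos hi']
      exact ⟨by omega, (Finset.mem_filter.1 hr).2⟩
    · rw [if_neg hi']
      exact hs.returns i hi'
  · dsimp only
    have hdisj : Disjoint s.activeᶜ ret :=
      (disjoint_compl_left (a := s.active)).mono_right hsub
    have hU : (s.active \ ret)ᶜ = s.activeᶜ.disjUnion ret hdisj := by
      ext i
      simp only [Finset.mem_compl, Finset.mem_sdiff, Finset.mem_disjUnion]
      tauto
    rw [hU, Finset.disjUnion_val, Multiset.map_add, hs.returned_eq]
    congr 1
    · refine Multiset.map_congr rfl fun i hi => ?_
      rw [if_neg (Finset.mem_compl.1 hi)]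
    · refine Multiset.map_congr rfl fun i hi => ?_
      rw [if_pos (hsub hi)]
  · dsimp only
    have hb : (s.active.val.bind fun i => ({h, perturbedAction h (p i)} : Multiset (E d)))
        = ∑ i ∈ s.active, ({h, perturbedAction h (p i)} : Multiset (E d)) := rfl
    rw [hb, hs.played_eq, ← Finset.sum_filter_add_sum_filter_not Finset.univ (· ∈ s.active)]
    rw [← Finset.sum_filter_add_sum_filter_not Finset.univ (· ∈ s.active)
      (fun i => (if i ∈ s.active then s.calls i + 1 else s.calls i) •
        ({h, perturbedAction h (p i)} : Multiset (E d)))]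
    have hf : Finset.univ.filter (· ∈ s.active) = s.active := by ext; simp
    rw [hf, add_right_comm, ← Finset.sum_add_distrib]
    congr 1
    · refine Finset.sum_congr rfl fun i hi => ?_
      rw [if_pos hi, add_smul, one_smul]
    · refine Finset.sum_congr rfl fun i hi => ?_
      rw [if_neg (Finset.mem_filter.1 hi).2]
  · intro i hi
    simp [hi, hs.calls_of_active i hi]

theorem run_succ (n : ℕ) :
    run θ h Δ p ξ (n + 1) = (run θ h Δ p ξ n).step θ h Δ p ξ := by
  rw [run, run, Function.iterate_succ_apply']

theorem invariant_run {n : ℕ} (hn : ∀ m < n, ¬ (run θ h Δ p ξ m).Done) :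
    Invariant θ h Δ p ξ (run θ h Δ p ξ n) n := by
  induction n with
  | zero => exact invariant_init θ h Δ p ξ
  | succ n ih =>
    rw [run_succ]
    exact ((ih fun m hm => hn m (by omega)).step θ h Δ p ξ (hn n (by omega))).1

variable {θ h Δ p ξ}

theorem Invariant.card_returned {s : State d k} {n : ℕ} (hs : Invariant θ h Δ p ξ s n) :
    s.returned.card = k - s.active.card := by
  rw [hs.returned_eq, Multiset.card_map, Finset.card_val, Finset.card_compl, Fintype.card_fin]

theorem Invariant.innerCalls_le {s : State d k} {n : ℕ} (hs : Invariant θ h Δ p ξ s n) :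
    (s.innerCalls : ℝ) ≤ k * n := by
  have : s.innerCalls ≤ ∑ _i : Fin k, n := Finset.sum_le_sum fun i _ => hs.calls_le i
  simp only [Finset.sum_const, Finset.card_univ, Fintype.card_fin, smul_eq_mul] at this
  exact_mod_cast this

theorem not_done_init (hk : 1 ≤ k) : ¬ (run θ h Δ p ξ 0).Done := by
  have : (1 : ℝ) ≤ k := by exact_mod_cast hk
  simp only [State.Done, run, Function.iterate_zero, id_eq, State.init, Multiset.card_zero,
    Nat.cast_zero, not_le]
  positivity

theorem FirstReturn.invariant {n : ℕ} (hk : 1 ≤ k) (hn : FirstReturn θ h Δ p ξ n) :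
    Invariant θ h Δ p ξ (run θ h Δ p ξ n) n := by
  refine invariant_run θ h Δ p ξ fun m hm => ?_
  rcases Nat.eq_zero_or_pos m with rfl | h0
  · exact not_done_init hk
  · exact hn.2.2 m h0 hm

/-- When the procedure returns, at least `0.33 k` instances have made all `n` calls. -/
theorem FirstReturn.le_innerCalls {n : ℕ} (hk : 1 ≤ k) (hn : FirstReturn θ h Δ p ξ n) :
    0.33 * k * n ≤ ((run θ h Δ p ξ n).innerCalls : ℝ) := by
  obtain ⟨m, rfl⟩ : ∃ m, n = m + 1 := ⟨n - 1, by have := hn.1; omega⟩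
  have hnd : ∀ j < m + 1, ¬ (run θ h Δ p ξ j).Done := by
    intro j hj
    rcases Nat.eq_zero_or_pos j with rfl | h0
    · exact not_done_init hk
    · exact hn.2.2 j h0 hj
  have hinv := invariant_run θ h Δ p ξ (n := m) fun j hj => hnd j (by omega)
  have hcalls := (hinv.step θ h Δ p ξ (hnd m (by omega))).2
  rw [← run_succ] at hcalls
  have hcard : (0.33 : ℝ) * k ≤ (run θ h Δ p ξ m).active.card := by
    have h1 := hnd m (by omega)
    rw [State.Done, hinv.card_returned, not_le, Nat.cast_sub] at h1
    · linarith
    · simpa using Finset.card_le_univ (run θ h Δ p ξ m).active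
  have h2 : (run θ h Δ p ξ m).active.card * (m + 1) ≤ (run θ h Δ p ξ (m + 1)).innerCalls := by
    calc _ = ∑ i ∈ (run θ h Δ p ξ m).active, (run θ h Δ p ξ (m + 1)).calls i := by
          rw [Finset.sum_congr rfl hcalls, Finset.sum_const, smul_eq_mul]
      _ ≤ _ := Finset.sum_le_sum_of_subset (Finset.subset_univ _)
  calc (0.33 : ℝ) * k * (m + 1 : ℕ) ≤ (run θ h Δ p ξ m).active.card * (m + 1 : ℕ) := by gcongr
    _ ≤ _ := by exact_mod_cast h2

/-- If all instances outside of a set `B` of at most `0.33 k` instances return by call `N`, the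
procedure returns by call `N`. -/
theorem exists_firstReturn {N : ℕ} (hk : 1 ≤ k) (hN : 1 ≤ N) (B : Finset (Fin k))
    (hB : (B.card : ℝ) ≤ 0.33 * k)
    (hret : ∀ i ∉ B, ∃ m, 1 ≤ m ∧ m ≤ N ∧ instReturns θ h (p i) (fun j b => ξ (i, j, b)) m) :
    ∃ n, FirstReturn θ h Δ p ξ n ∧ n ≤ N := by
  classical
  have hex : ∃ n, 1 ≤ n ∧ n ≤ N ∧ (run θ h Δ p ξ n).Done := by
    by_contra! hcon
    have hinv : Invariant θ h Δ p ξ (run θ h Δ p ξ N) N := by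
      refine invariant_run θ h Δ p ξ fun m hm => ?_
      rcases Nat.eq_zero_or_pos m with rfl | h0
      · exact not_done_init hk
      · exact hcon m h0 hm.le
    refine hcon N hN le_rfl ?_
    have hsub : (run θ h Δ p ξ N).active ⊆ B := by
      intro i hi
      by_contra hiB
      obtain ⟨m, h1, h2, h3⟩ := hret i hiB
      exact hinv.not_returns i hi m h1 h2 h3
    have hle : ((run θ h Δ p ξ N).active.card : ℝ) ≤ 0.33 * k :=
      le_trans (by exact_mod_cast Finset.card_le_card hsub) hB
    rw [State.Done, hinv.card_returned, Nat.cast_sub]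
    · linarith
    · simpa using Finset.card_le_univ (run θ h Δ p ξ N).active
  refine ⟨Nat.find hex, ⟨(Nat.find_spec hex).1, (Nat.find_spec hex).2.2, fun m h1 h2 h3 => ?_⟩,
    (Nat.find_spec hex).2.1⟩
  have := (Nat.find_spec hex).2.1
  exact Nat.find_min hex h2 ⟨h1, by omega, h3⟩

theorem FirstReturn.median_mem_Icc {n : ℕ} (hk : 1 ≤ k) (hn : FirstReturn θ h Δ p ξ n)
    (B : Finset (Fin k)) (hB : (B.card : ℝ) ≤ 0.33 * k) {a b : ℝ}
    (hval : ∀ i ∉ B, ∀ m, 1 ≤ m → instReturns θ h (p i) (fun j b => ξ (i, j, b)) m →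
      a ≤ instValue θ h Δ (p i) (fun j b => ξ (i, j, b)) m ∧
        instValue θ h Δ (p i) (fun j b => ξ (i, j, b)) m ≤ b) :
    a ≤ median (run θ h Δ p ξ n).returned ∧ median (run θ h Δ p ξ n).returned ≤ b := by
  classical
  have hinv := hn.invariant hk
  refine HintBandit.median_mem_Icc _ a b ?_
  have hd : 0.67 * (k : ℝ) ≤ _ := hn.2.1
  have hk' : (1 : ℝ) ≤ k := by exact_mod_cast hk
  have hc : (run θ h Δ p ξ n).returned.countP (fun x => ¬ (a ≤ x ∧ x ≤ b)) ≤ B.card := by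
    rw [hinv.returned_eq, Multiset.countP_map]
    refine Finset.card_le_card (s := (run θ h Δ p ξ n).activeᶜ.filter fun i =>
      ¬ (a ≤ instValue θ h Δ (p i) (fun j b => ξ (i, j, b)) ((run θ h Δ p ξ n).calls i) ∧
        instValue θ h Δ (p i) (fun j b => ξ (i, j, b)) ((run θ h Δ p ξ n).calls i) ≤ b))
      (t := B) ?_
    intro i hi
    obtain ⟨h1, h2⟩ := Finset.mem_filter.1 hi
    by_contra hiB
    obtain ⟨h3, h4⟩ := hinv.returns i (Finset.mem_compl.1 h1)
    exact h2 (hval i hiB _ h3 h4)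
  have : (2 * (run θ h Δ p ξ n).returned.countP (fun x => ¬ (a ≤ x ∧ x ≤ b)) : ℝ)
      < (run θ h Δ p ξ n).returned.card := by
    have : ((run θ h Δ p ξ n).returned.countP (fun x => ¬ (a ≤ x ∧ x ≤ b)) : ℝ) ≤ B.card := by
      exact_mod_cast hc
    linarith
  exact_mod_cast this

theorem Invariant.regret_eq {s : State d k} {n : ℕ} (hs : Invariant θ h Δ p ξ s n) (b : E d) :
    s.regret θ b =
      ∑ i, (s.calls i : ℝ) * (⟪θ, b - h⟫ + ⟪θ, b - perturbedAction h (p i)⟫) := by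
  rw [State.regret, hs.played_eq]
  let F : Multiset (E d) →+ ℝ :=
    { toFun := fun t => (t.map fun a => ⟪θ, b - a⟫).sum
      map_zero' := by simp
      map_add' := by simp }
  change F _ = _
  rw [map_sum]
  refine Finset.sum_congr rfl fun i _ => ?_
  rw [map_nsmul, nsmul_eq_mul]
  congr 1
  have hF : ∀ t, F t = (t.map fun a => ⟪θ, b - a⟫).sum := fun _ => rfl
  rw [hF]
  simp

end HintBandit

namespace HintBandit

/-! ### A maximal inequality for products of independent variables -/

open scoped ENNReal

/-- The partial products of `y`, stopped once they reach the level `c`. -/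
noncomputable def stoppedProd (c : ℝ≥0∞) (y : ℕ → ℝ≥0∞) : ℕ → ℝ≥0∞
  | 0 => 1
  | n + 1 => if c ≤ stoppedProd c y n then stoppedProd c y n else stoppedProd c y n * y n

theorem stoppedProd_congr (c : ℝ≥0∞) {y z : ℕ → ℝ≥0∞} {n : ℕ} (h : ∀ i < n, y i = z i) :
    stoppedProd c y n = stoppedProd c z n := by
  induction n with
  | zero => rfl
  | succ n ih =>
    rw [stoppedProd, stoppedProd, ih fun i hi => h i (by omega), h n (by omega)]

theorem stoppedProd_eq_prod_or_le (c : ℝ≥0∞) (y : ℕ → ℝ≥0∞) (n : ℕ) :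
    stoppedProd c y n = ∏ i ∈ Finset.range n, y i ∨ c ≤ stoppedProd c y n := by
  induction n with
  | zero => left; simp [stoppedProd]
  | succ n ih =>
    rw [stoppedProd]
    split_ifs with h
    · exact Or.inr h
    · left
      rw [Finset.prod_range_succ, ih.resolve_right h]

theorem le_stoppedProd_mono {c : ℝ≥0∞} {y : ℕ → ℝ≥0∞} {m n : ℕ} (hmn : m ≤ n)
    (h : c ≤ stoppedProd c y m) : c ≤ stoppedProd c y n := by
  induction n, hmn using Nat.le_induction with
  | base => exact h
  | succ n _ ih => rw [stoppedProd, if_pos ih]; exact ih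

theorem le_stoppedProd_of_le_prod {c : ℝ≥0∞} {y : ℕ → ℝ≥0∞} {m n : ℕ} (hmn : m ≤ n)
    (h : c ≤ ∏ i ∈ Finset.range m, y i) : c ≤ stoppedProd c y n := by
  refine le_stoppedProd_mono hmn ?_
  rcases stoppedProd_eq_prod_or_le c y m with h' | h'
  · rwa [h']
  · exact h'

@[fun_prop]
theorem measurable_stoppedProd {α : Type*} [MeasurableSpace α] (c : ℝ≥0∞) {Y : ℕ → α → ℝ≥0∞}
    (hY : ∀ n, Measurable (Y n)) (n : ℕ) :
    Measurable fun ω => stoppedProd c (fun i => Y i ω) n := by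
  induction n with
  | zero => exact measurable_const
  | succ n ih =>
    simp only [stoppedProd]
    exact Measurable.ite (measurableSet_le measurable_const ih) ih (ih.mul (hY n))

variable {Ω : Type*} [MeasurableSpace Ω] {μ : Measure Ω}

theorem indepFun_stoppedProd (c : ℝ≥0∞) {Y : ℕ → Ω → ℝ≥0∞} (hY : ∀ n, Measurable (Y n))
    (hind : iIndepFun Y μ) (n : ℕ) :
    IndepFun (fun ω => stoppedProd c (fun i => Y i ω) n) (Y n) μ := by
  have h1 := hind.indepFun_finset (Finset.range n) {n} (by simp) hY
  let φ : (Finset.range n → ℝ≥0∞) → ℝ≥0∞ := fun y =>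
    stoppedProd c (fun i => if hi : i ∈ Finset.range n then y ⟨i, hi⟩ else 0) n
  have hφ : Measurable φ := by
    refine measurable_stoppedProd c (Y := fun i (y : Finset.range n → ℝ≥0∞) =>
      if hi : i ∈ Finset.range n then y ⟨i, hi⟩ else 0) (fun i => ?_) n
    by_cases hi : i ∈ Finset.range n
    · simp only [hi, dite_true]
      exact measurable_pi_apply _
    · simp only [hi, dite_false]
      exact measurable_const
  have h2 := h1.comp hφ
    (measurable_pi_apply (⟨n, by simp⟩ : ({n} : Finset ℕ)) :
      Measurable fun y : ({n} : Finset ℕ) → ℝ≥0∞ => y ⟨n, by simp⟩)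
  have h3 : (fun ω => stoppedProd c (fun i => Y i ω) n) =
      φ ∘ fun ω (i : Finset.range n) => Y i ω := by
    ext ω
    refine stoppedProd_congr c fun i hi => ?_
    simp [hi]
  rw [h3]
  exact h2

theorem lintegral_stoppedProd_le [IsProbabilityMeasure μ] (c : ℝ≥0∞) {Y : ℕ → Ω → ℝ≥0∞}
    (hY : ∀ n, Measurable (Y n)) (hind : iIndepFun Y μ) (h1 : ∀ n, ∫⁻ ω, Y n ω ∂μ ≤ 1) (n : ℕ) :
    ∫⁻ ω, stoppedProd c (fun i => Y i ω) n ∂μ ≤ 1 := by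
  induction n with
  | zero => simp [stoppedProd]
  | succ n ih =>
    refine le_trans ?_ ih
    set Z : Ω → ℝ≥0∞ := fun ω => stoppedProd c (fun i => Y i ω) n with hZ
    have hZm : Measurable Z := measurable_stoppedProd c hY n
    let f : ℝ≥0∞ → ℝ≥0∞ := fun z => if c ≤ z then z else 0
    let g : ℝ≥0∞ → ℝ≥0∞ := fun z => if c ≤ z then 0 else z
    have hf : Measurable f := Measurable.ite measurableSet_Ici measurable_id measurable_const
    have hg : Measurable g := Measurable.ite measurableSet_Ici measurable_const measurable_id
    have hfZ : Measurable fun ω => f (Z ω) := hf.comp hZm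
    calc ∫⁻ ω, stoppedProd c (fun i => Y i ω) (n + 1) ∂μ
        = ∫⁻ ω, (f (Z ω) + g (Z ω) * Y n ω) ∂μ := by
          refine lintegral_congr fun ω => ?_
          by_cases hc : c ≤ stoppedProd c (fun i => Y i ω) n <;> simp [stoppedProd, f, g, hZ, hc]
      _ = ∫⁻ ω, f (Z ω) ∂μ + (∫⁻ ω, g (Z ω) ∂μ) * ∫⁻ ω, Y n ω ∂μ := by
          rw [lintegral_add_left hfZ]
          congr 1
          exact lintegral_mul_eq_lintegral_mul_lintegral_of_indepFun (hg.comp hZm) (hY n)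
            ((indepFun_stoppedProd c hY hind n).comp hg measurable_id)
      _ ≤ ∫⁻ ω, f (Z ω) ∂μ + (∫⁻ ω, g (Z ω) ∂μ) * 1 := by gcongr; exact h1 n
      _ = ∫⁻ ω, Z ω ∂μ := by
          rw [mul_one, ← lintegral_add_left hfZ]
          refine lintegral_congr fun ω => ?_
          by_cases hc : c ≤ Z ω <;> simp [f, g, hc]

/-- Ville's inequality for the partial products of independent variables of mean at most `1`. -/
theorem measure_exists_le_prod_le [IsProbabilityMeasure μ] {c : ℝ≥0∞} (hc : c ≠ 0) (hc' : c ≠ ∞)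
    {Y : ℕ → Ω → ℝ≥0∞} (hY : ∀ n, Measurable (Y n)) (hind : iIndepFun Y μ)
    (h1 : ∀ n, ∫⁻ ω, Y n ω ∂μ ≤ 1) (N : ℕ) :
    μ {ω | ∃ m ≤ N, c ≤ ∏ i ∈ Finset.range m, Y i ω} ≤ c⁻¹ := by
  calc μ {ω | ∃ m ≤ N, c ≤ ∏ i ∈ Finset.range m, Y i ω}
      ≤ μ {ω | c ≤ stoppedProd c (fun i => Y i ω) N} := by
        refine measure_mono ?_
        rintro ω ⟨m, hm, h⟩
        exact le_stoppedProd_of_le_prod hm h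
    _ ≤ (∫⁻ ω, stoppedProd c (fun i => Y i ω) N ∂μ) / c :=
        meas_ge_le_lintegral_div (measurable_stoppedProd c hY N).aemeasurable hc hc'
    _ ≤ 1 / c := by gcongr; exact lintegral_stoppedProd_le c hY hind h1 N
    _ = c⁻¹ := one_div c

/-- The probability that a sub-Gaussian random walk crosses a line. -/
theorem measure_exists_line_crossing_le [IsProbabilityMeasure μ] {η : ℕ → Ω → ℝ} {s : NNReal}
    (hm : ∀ n, Measurable (η n)) (hind : iIndepFun η μ)
    (hs : ∀ n, HasSubgaussianMGF (η n) s μ) (t c : ℝ) (N : ℕ) :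
    μ {ω | ∃ m ≤ N, c ≤ t * (∑ i ∈ Finset.range m, η i ω) - m * (s * t ^ 2 / 2)} ≤
      ENNReal.ofReal (Real.exp (-c)) := by
  let ψ : ℝ → ℝ≥0∞ := fun x => ENNReal.ofReal (Real.exp (t * x - s * t ^ 2 / 2))
  have hψ : Measurable ψ := by fun_prop
  have hint : ∀ n, ∫⁻ ω, ψ (η n ω) ∂μ ≤ 1 := by
    intro n
    have hi : Integrable (fun ω => Real.exp (t * η n ω - s * t ^ 2 / 2)) μ := by
      simp_rw [Real.exp_sub]
      exact ((hs n).integrable_exp_mul t).div_const _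
    rw [← ofReal_integral_eq_lintegral_ofReal hi (ae_of_all _ fun _ => (Real.exp_pos _).le)]
    rw [← ENNReal.ofReal_one]
    refine ENNReal.ofReal_le_ofReal ?_
    simp_rw [Real.exp_sub]
    rw [integral_div, div_le_one (Real.exp_pos _)]
    exact (hs n).mgf_le t
  have h := measure_exists_le_prod_le (μ := μ) (c := ENNReal.ofReal (Real.exp c))
    (by simp [Real.exp_pos]) (by simp) (Y := fun n ω => ψ (η n ω)) (fun n => hψ.comp (hm n))
    (hind.comp (fun _ => ψ) fun _ => hψ) hint N
  rw [← ENNReal.ofReal_inv_of_pos (Real.exp_pos _), ← Real.exp_neg] at h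
  refine le_trans (measure_mono ?_) h
  rintro ω ⟨m, hmN, hmc⟩
  refine ⟨m, hmN, ?_⟩
  rw [← ENNReal.ofReal_prod_of_nonneg fun _ _ => (Real.exp_pos _).le, ← Real.exp_sum]
  refine ENNReal.ofReal_le_ofReal (Real.exp_le_exp.2 ?_)
  rw [Finset.sum_sub_distrib, ← Finset.mul_sum, Finset.sum_const, Finset.card_range, nsmul_eq_mul]
  exact hmc

/-! ### The iterated-logarithm bound -/

theorem le_log_mul_log {j n : ℕ} (hn : 4 ^ j ≤ n) :
    Real.log (27 * (2 * j + 1)) ≤ Real.log (40 * Real.log (2 * n)) := by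
  refine Real.log_le_log (by positivity) ?_
  have h1 : Real.log (2 * 4 ^ j) ≤ Real.log (2 * n) := by
    refine Real.log_le_log (by positivity) ?_
    have : ((4 : ℝ) ^ j) ≤ n := by exact_mod_cast hn
    linarith
  have h2 : Real.log (2 * 4 ^ j) = (2 * j + 1) * Real.log 2 := by
    rw [Real.log_mul (by norm_num) (by positivity), Real.log_pow,
      show (4 : ℝ) = 2 ^ 2 by norm_num, Real.log_pow]
    push_cast
    ring
  have h3 : (2 * (j : ℝ) + 1) * 0.693 ≤ (2 * j + 1) * Real.log 2 := by
    have := Real.log_two_gt_d9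
    gcongr
    linarith
  have : (0 : ℝ) ≤ j := by positivity
  linarith

theorem measure_block_le [IsProbabilityMeasure μ] {η : ℕ → Ω → ℝ} {s : NNReal} (hs0 : 0 < s)
    (hm : ∀ n, Measurable (η n)) (hind : iIndepFun η μ)
    (hs : ∀ n, HasSubgaussianMGF (η n) s μ) (j : ℕ) :
    μ {ω | ∃ n : ℕ, 4 ^ j ≤ n ∧ n < 4 ^ (j + 1) ∧
        √(3 * s * Real.log (40 * Real.log (2 * n)) * n) < ∑ i ∈ Finset.range n, η i ω} ≤
      ENNReal.ofReal (((27 : ℝ) * (2 * j + 1)) ^ (-(4 / 3) : ℝ)) := by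
  set Λ := Real.log (27 * (2 * j + 1)) with hΛ
  have hj : (0 : ℝ) ≤ j := by positivity
  have hΛ0 : 0 < Λ := Real.log_pos (by linarith)
  have hs0' : (0 : ℝ) < s := hs0
  set σ := √(s : ℝ) with hσ
  have hσ0 : 0 < σ := Real.sqrt_pos.2 hs0'
  have hσ2 : σ ^ 2 = s := Real.sq_sqrt hs0'.le
  set a := √(3 * Λ) with ha
  have ha0 : 0 < a := Real.sqrt_pos.2 (by positivity)
  have ha2 : a ^ 2 = 3 * Λ := Real.sq_sqrt (by positivity)
  set r : ℝ := 2 ^ j with hr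
  have hr0 : 0 < r := by positivity
  have hr2 : r ^ 2 = 4 ^ j := by rw [hr, ← pow_mul, mul_comm, pow_mul]; norm_num
  have key := measure_exists_line_crossing_le (μ := μ) hm hind hs (2 * a / (3 * σ * r))
    (4 / 3 * Λ) (4 ^ (j + 1))
  have hexp : Real.exp (-(4 / 3 * Λ)) = ((27 : ℝ) * (2 * j + 1)) ^ (-(4 / 3) : ℝ) := by
    rw [Real.rpow_def_of_pos (by positivity), ← hΛ]
    ring_nf
  rw [hexp] at key
  refine le_trans (measure_mono ?_) key
  rintro ω ⟨n, hn1, hn2, hS⟩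
  refine ⟨n, hn2.le, ?_⟩
  set S := ∑ i ∈ Finset.range n, η i ω with hSdef
  set q := √(n : ℝ) with hq
  have hq2 : q ^ 2 = n := Real.sq_sqrt (by positivity)
  have hq1 : r ≤ q := by
    rw [hq]
    refine Real.le_sqrt_of_sq_le ?_
    rw [hr2]
    exact_mod_cast hn1
  have hq3 : q ≤ 2 * r := by
    rw [hq]
    refine Real.sqrt_le_iff.2 ⟨by positivity, ?_⟩
    rw [mul_pow, hr2]
    have : (n : ℝ) ≤ 4 ^ (j + 1) := by exact_mod_cast hn2.le
    rw [pow_succ] at this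
    linarith
  have hlow : σ * a * q ≤ S := by
    refine le_trans ?_ hS.le
    rw [hσ, ha, hq, ← Real.sqrt_mul hs0'.le, ← Real.sqrt_mul (by positivity)]
    refine Real.sqrt_le_sqrt ?_
    have := le_log_mul_log hn1
    rw [show (s : ℝ) * (3 * Λ) * n = 3 * s * Λ * n by ring]
    gcongr
  have hchord : 2 * r / 3 + q ^ 2 / (3 * r) ≤ q := by
    rw [div_add_div _ _ (by norm_num) (by positivity), div_le_iff₀ (by positivity)]
    nlinarith [mul_nonneg (sub_nonneg.2 hq1) (sub_nonneg.2 hq3)]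
  have hS2 : σ * a * (2 * r / 3 + q ^ 2 / (3 * r)) ≤ S :=
    le_trans (by gcongr) hlow
  have ht0 : 0 < 2 * a / (3 * σ * r) := by positivity
  have := mul_le_mul_of_nonneg_left hS2 ht0.le
  have e1 : 2 * a / (3 * σ * r) * (σ * a * (2 * r / 3 + q ^ 2 / (3 * r)))
      = a ^ 2 * (4 / 9 + 2 * q ^ 2 / (9 * r ^ 2)) := by
    field_simp
    ring
  have e2 : (n : ℝ) * (s * (2 * a / (3 * σ * r)) ^ 2 / 2) = a ^ 2 * (2 * q ^ 2 / (9 * r ^ 2)) := by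
    rw [← hq2, ← hσ2]
    field_simp
    ring
  rw [e2]
  rw [e1] at this
  have e3 : a ^ 2 * (4 / 9) = 4 / 3 * Λ := by rw [ha2]; ring
  linarith

theorem sum_rpow_le (N : ℕ) :
    ∑ j ∈ Finset.range (N + 1), ((27 : ℝ) * (2 * j + 1)) ^ (-(4 / 3) : ℝ) ≤
      1 / 81 * (5 / 2 - 3 / 2 * ((2 * N + 1 : ℝ)) ^ (-(1 / 3) : ℝ)) := by
  have h27 : ∀ x : ℝ, 0 ≤ x → (27 * x) ^ (-(4 / 3) : ℝ) = 1 / 81 * x ^ (-(4 / 3) : ℝ) := by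
    intro x hx
    rw [Real.mul_rpow (by norm_num) hx, show (27 : ℝ) = 3 ^ (3 : ℝ) by norm_num,
      ← Real.rpow_mul (by norm_num)]
    norm_num
  induction N with
  | zero => norm_num
  | succ N ih =>
    rw [Finset.sum_range_succ, h27 _ (by positivity)]
    push_cast
    set a : ℝ := (2 * N + 1 : ℝ) ^ (1 / 3 : ℝ) with ha
    set b : ℝ := (2 * (N + 1) + 1 : ℝ) ^ (1 / 3 : ℝ) with hb
    have ha0 : 0 < a := by positivity
    have hb0 : 0 < b := by positivity
    have ha3 : a ^ 3 = 2 * N + 1 := by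
      rw [ha, ← Real.rpow_natCast, ← Real.rpow_mul (by positivity)]; norm_num
    have hb3 : b ^ 3 = 2 * (N + 1) + 1 := by
      rw [hb, ← Real.rpow_natCast, ← Real.rpow_mul (by positivity)]; norm_num
    have ha1 : (2 * N + 1 : ℝ) ^ (-(1 / 3) : ℝ) = 1 / a := by
      rw [Real.rpow_neg (by positivity), inv_eq_one_div]
    have hb1 : (2 * (N + 1) + 1 : ℝ) ^ (-(1 / 3) : ℝ) = 1 / b := by
      rw [Real.rpow_neg (by positivity), inv_eq_one_div]
    have hb4 : (2 * (N + 1) + 1 : ℝ) ^ (-(4 / 3) : ℝ) = 1 / b ^ 4 := by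
      rw [Real.rpow_neg (by positivity), hb, ← Real.rpow_natCast, ← Real.rpow_mul (by positivity)]
      norm_num
    rw [ha1] at ih
    rw [hb1, hb4]
    have hab : a ≤ b := by
      rw [ha, hb]
      exact Real.rpow_le_rpow (by positivity) (by linarith) (by norm_num)
    have h2 : (b - a) * (a ^ 2 + a * b + b ^ 2) = 2 := by linear_combination hb3 - ha3
    have h3 : 1 / b ^ 4 ≤ 3 / 2 * (1 / a - 1 / b) := by
      have h5 : a ^ 2 + a * b + b ^ 2 ≤ 3 * b ^ 2 := by nlinarith
      have h4 : 2 ≤ (b - a) * (3 * b ^ 2) := by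
        rw [← h2]; exact mul_le_mul_of_nonneg_left h5 (by linarith)
      rw [div_sub_div _ _ ha0.ne' hb0.ne', ← mul_div_assoc,
        div_le_div_iff₀ (by positivity) (by positivity)]
      nlinarith [mul_le_mul_of_nonneg_left h4 (by positivity : 0 ≤ b ^ 2),
        mul_le_mul_of_nonneg_right hab hb0.le]
    linarith

/-- The event that the random walk with steps `x` leaves the iterated-logarithm envelope of
variance proxy `s`. -/
def escapes (s : ℝ) (x : ℕ → ℝ) : Prop :=
  ∃ n : ℕ, 1 ≤ n ∧ √(3 * s * Real.log (40 * Real.log (2 * n)) * n) < |∑ i ∈ Finset.range n, x i|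

theorem measure_escapes_le [IsProbabilityMeasure μ] {η : ℕ → Ω → ℝ} {s : NNReal} (hs0 : 0 < s)
    (hm : ∀ n, Measurable (η n)) (hind : iIndepFun η μ)
    (hs : ∀ n, HasSubgaussianMGF (η n) s μ) :
    μ {ω | escapes s fun i => η i ω} ≤ ENNReal.ofReal 0.062 := by
  let A : (ℕ → Ω → ℝ) → ℕ → Set Ω := fun η j => {ω | ∃ n : ℕ, 4 ^ j ≤ n ∧ n < 4 ^ (j + 1) ∧
        √(3 * s * Real.log (40 * Real.log (2 * n)) * n) < ∑ i ∈ Finset.range n, η i ω}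
  have hA : ∀ j, μ (A η j) ≤ ENNReal.ofReal (((27 : ℝ) * (2 * j + 1)) ^ (-(4 / 3) : ℝ)) :=
    measure_block_le hs0 hm hind hs
  have hA' : ∀ j, μ (A (fun n => -η n) j) ≤
      ENNReal.ofReal (((27 : ℝ) * (2 * j + 1)) ^ (-(4 / 3) : ℝ)) :=
    measure_block_le hs0 (fun n => (hm n).neg)
      (hind.comp (fun _ x => -x) fun _ => measurable_neg) (fun n => (hs n).neg)
  have hsub : {ω | escapes s fun i => η i ω} ⊆ ⋃ j, (A η j ∪ A (fun n => -η n) j) := by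
    rintro ω ⟨n, hn, h⟩
    refine Set.mem_iUnion.2 ⟨Nat.log 4 n, ?_⟩
    have h1 := Nat.pow_log_le_self 4 (x := n) (by omega)
    have h2 := Nat.lt_pow_succ_log_self (b := 4) (by norm_num) n
    rcases lt_abs.1 h with h | h
    · exact Or.inl ⟨n, h1, h2, h⟩
    · refine Or.inr ⟨n, h1, h2, ?_⟩
      simpa using h
  calc μ {ω | escapes s fun i => η i ω} ≤ μ (⋃ j, (A η j ∪ A (fun n => -η n) j)) :=
        measure_mono hsub
    _ ≤ ∑' j, μ (A η j ∪ A (fun n => -η n) j) := measure_iUnion_le _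
    _ ≤ ∑' j : ℕ, ENNReal.ofReal (2 * ((27 : ℝ) * (2 * j + 1)) ^ (-(4 / 3) : ℝ)) := by
        refine ENNReal.tsum_le_tsum fun j => (measure_union_le _ _).trans ?_
        rw [two_mul, ENNReal.ofReal_add (by positivity) (by positivity)]
        exact add_le_add (hA j) (hA' j)
    _ ≤ ENNReal.ofReal 0.062 := by
        refine ENNReal.tsum_le_of_sum_range_le fun N => ?_
        rw [← ENNReal.ofReal_sum_of_nonneg fun _ _ => by positivity]
        refine ENNReal.ofReal_le_ofReal ?_
        rw [← Finset.mul_sum]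
        have h1 := sum_rpow_le N
        have h2 : (0 : ℝ) ≤ (2 * N + 1 : ℝ) ^ (-(1 / 3) : ℝ) := by positivity
        have h3 : ∑ j ∈ Finset.range N, ((27 : ℝ) * (2 * j + 1)) ^ (-(4 / 3) : ℝ) ≤
            ∑ j ∈ Finset.range (N + 1), ((27 : ℝ) * (2 * j + 1)) ^ (-(4 / 3) : ℝ) :=
          Finset.sum_le_sum_of_subset_of_nonneg (Finset.range_mono (by omega))
            fun _ _ _ => by positivity
        norm_num at h1 h2 h3 ⊢
        linarith

end HintBandit

namespace HintBandit

/-! ### Gaussian estimates -/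

open scoped ENNReal

theorem lintegral_exp_sq_gaussianReal :
    ∫⁻ x, ENNReal.ofReal (Real.exp (x ^ 2 / 4)) ∂(gaussianReal 0 1) = ENNReal.ofReal (√2) := by
  rw [gaussianReal_of_var_ne_zero 0 one_ne_zero,
    lintegral_withDensity_eq_lintegral_mul _ (measurable_gaussianPDF 0 1) (by fun_prop)]
  have h1 : ∀ x : ℝ, (gaussianPDF 0 1 * fun x => ENNReal.ofReal (Real.exp (x ^ 2 / 4))) x =
      ENNReal.ofReal ((√(2 * Real.pi))⁻¹ * Real.exp (-(1 / 4) * x ^ 2)) := by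
    intro x
    rw [Pi.mul_apply, gaussianPDF, ← ENNReal.ofReal_mul (gaussianPDFReal_nonneg _ _ _),
      gaussianPDFReal_def]
    simp only [NNReal.coe_one, mul_one, sub_zero]
    rw [mul_assoc, ← Real.exp_add]
    ring_nf
  simp_rw [h1]
  rw [← ofReal_integral_eq_lintegral_ofReal
    ((integrable_exp_neg_mul_sq (by norm_num : (0 : ℝ) < 1 / 4)).const_mul _)
    (ae_of_all _ fun _ => by positivity), integral_const_mul, integral_gaussian]
  congr 1
  have : √(2 * Real.pi) ≠ 0 := (Real.sqrt_pos.2 (by positivity)).ne'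
  rw [show Real.pi / (1 / 4) = 2 * (2 * Real.pi) by ring,
    Real.sqrt_mul (by norm_num) (2 * Real.pi), mul_left_comm, inv_mul_cancel₀ this, mul_one]

theorem gaussianReal_abs_lt_le : gaussianReal 0 1 {x | |x| < 0.09} ≤ ENNReal.ofReal 0.072 := by
  rw [gaussianReal_apply 0 one_ne_zero]
  have hb : ∀ x, gaussianPDF 0 1 x ≤ ENNReal.ofReal 0.4 := by
    intro x
    refine ENNReal.ofReal_le_ofReal ?_
    rw [gaussianPDFReal_def]
    have h1 : (2.5 : ℝ) ≤ √(2 * Real.pi * 1) := by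
      refine Real.le_sqrt_of_sq_le ?_
      have := Real.pi_gt_d2
      norm_num at this ⊢
      linarith
    have h2 : Real.exp (-(x - 0) ^ 2 / (2 * 1)) ≤ 1 := by
      rw [Real.exp_le_one_iff]
      have := sq_nonneg (x - 0)
      linarith
    have h3 : (√(2 * Real.pi * 1))⁻¹ ≤ 0.4 :=
      (inv_anti₀ (by norm_num) h1).trans (by norm_num)
    simp only [NNReal.coe_one]
    calc (√(2 * Real.pi * 1))⁻¹ * Real.exp (-(x - 0) ^ 2 / (2 * 1)) ≤ 0.4 * 1 := by gcongr
      _ = 0.4 := by norm_num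
  calc ∫⁻ x in {x | |x| < 0.09}, gaussianPDF 0 1 x
      ≤ ∫⁻ _ in {x : ℝ | |x| < 0.09}, ENNReal.ofReal 0.4 := lintegral_mono fun x => hb x
    _ = ENNReal.ofReal 0.4 * volume {x : ℝ | |x| < 0.09} := by
        rw [lintegral_const, Measure.restrict_apply_univ]
    _ = ENNReal.ofReal 0.072 := by
        have : {x : ℝ | |x| < 0.09} = Set.Ioo (-0.09) 0.09 := by
          ext x; simp [abs_lt]
        rw [this, Real.volume_Ioo, ← ENNReal.ofReal_mul (by norm_num)]
        norm_num

theorem hasSubgaussianMGF_id_gaussianReal : HasSubgaussianMGF id 1 (gaussianReal 0 1) where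
  integrable_exp_mul t := integrable_exp_mul_gaussianReal t
  mgf_le t := by rw [mgf_id_gaussianReal]; simp

theorem gaussianReal_lt_abs_le : gaussianReal 0 1 {x | 2.5 < |x|} ≤ ENNReal.ofReal 0.09 := by
  have h1 := hasSubgaussianMGF_id_gaussianReal.measure_ge_le (ε := 2.5) (by norm_num)
  have h2 := hasSubgaussianMGF_id_gaussianReal.neg.measure_ge_le (ε := 2.5) (by norm_num)
  have h3 : Real.exp (-2.5 ^ 2 / (2 * (1 : NNReal))) ≤ 0.045 := by
    have e1 : (2.718 : ℝ) ≤ Real.exp 1 := by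
      have := Real.exp_one_gt_d9
      linarith
    have e2 : Real.exp (3.125 : ℝ) = Real.exp 1 ^ 3 * Real.exp 0.125 := by
      rw [← Real.exp_nat_mul, ← Real.exp_add]; norm_num
    have e3 : (1.125 : ℝ) ≤ Real.exp 0.125 := by
      have := Real.add_one_le_exp (0.125 : ℝ)
      linarith
    have e4 : (2.718 : ℝ) ^ 3 * 1.125 ≤ Real.exp 3.125 := by rw [e2]; gcongr
    have e5 : (-2.5 ^ 2 / (2 * (1 : NNReal)) : ℝ) = -3.125 := by norm_num
    rw [e5, Real.exp_neg]
    exact (inv_anti₀ (by norm_num) e4).trans (by norm_num)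
  have hsub : {x : ℝ | 2.5 < |x|} ⊆ {x | 2.5 ≤ id x} ∪ {x | 2.5 ≤ (-id) x} := by
    intro x hx
    rcases lt_abs.1 (show 2.5 < |x| from hx) with h | h
    · exact Or.inl h.le
    · exact Or.inr h.le
  rw [ENNReal.le_ofReal_iff_toReal_le (measure_ne_top _ _) (by norm_num)]
  have h4 := (measureReal_mono (μ := gaussianReal 0 1) hsub).trans (measureReal_union_le _ _)
  have h5 : (gaussianReal 0 1).real {x : ℝ | 2.5 < |x|} ≤ 0.09 := by
    norm_num at h1 h2 h3 h4 ⊢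
    linarith
  exact h5

theorem stdGaussian_map_inner {d : ℕ} {u : E d} (hu : ‖u‖ = 1) :
    (stdGaussian (E d)).map (fun g => ⟪u, g⟫) = gaussianReal 0 1 := by
  have h := IsGaussian.map_eq_gaussianReal (μ := stdGaussian (E d)) (innerSL ℝ u)
  rw [integral_strongDual_stdGaussian, variance_dual_stdGaussian, innerSL_apply_norm, hu] at h
  simpa using h

variable {d : ℕ}

/-- The exponent whose sum over the instances controls the regret. -/
noncomputable def energy (θ h : E d) (Δ : ℝ) (p : E d) : ℝ :=
  ‖p‖ ^ 2 / (8 * Δ ^ 2) + effDim h * ⟪p, θ⟫ ^ 2 / (8 * Δ ^ 2 * ‖perp h θ‖ ^ 2)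

@[fun_prop]
theorem measurable_energy (θ h : E d) (Δ : ℝ) : Measurable (energy θ h Δ) := by
  unfold energy; fun_prop

theorem effDim_pos {θ h : E d} (hθ : perp h θ ≠ 0) : 0 < effDim h := by
  have hd : 0 < d := by
    by_contra hd
    obtain rfl : d = 0 := by omega
    exact hθ (Subsingleton.elim _ _)
  unfold effDim
  split_ifs with hh
  · exact hd
  · by_contra hd1
    obtain rfl : d = 1 := by omega
    have htop : Submodule.span ℝ {h} = ⊤ := by
      refine Submodule.eq_top_of_finrank_eq ?_
      rw [finrank_span_singleton hh, finrank_euclideanSpace_fin]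
    refine hθ ?_
    have : perp h θ ∈ (Submodule.span ℝ {h})ᗮ := Submodule.starProjection_apply_mem _ _
    rw [htop, Submodule.top_orthogonal_eq_bot] at this
    simpa using this

theorem finrank_orthogonal_span (h : E d) :
    Module.finrank ℝ (Submodule.span ℝ {h})ᗮ = effDim h := by
  have h1 := (Submodule.span ℝ {h}).finrank_add_finrank_orthogonal
  rw [finrank_euclideanSpace_fin] at h1
  unfold effDim
  split_ifs with hh
  · rw [hh, Submodule.span_zero_singleton, finrank_bot] at h1
    rw [hh, Submodule.span_zero_singleton]
    omega
  · rw [finrank_span_singleton hh] at h1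
    omega

theorem inner_perp_left (h g θ : E d) : ⟪perp h g, θ⟫ = ⟪perp h θ, g⟫ := by
  unfold perp
  rw [Submodule.inner_starProjection_left_eq_right, real_inner_comm]

theorem measurable_perp (h : E d) : Measurable (perp h) := by
  unfold perp; fun_prop

theorem exists_norm_perp_sq_eq_sum (h : E d) :
    ∃ e : Fin (effDim h) → E d, (∀ i, ‖e i‖ = 1) ∧ ∀ g, ‖perp h g‖ ^ 2 = ∑ i, ⟪e i, g⟫ ^ 2 := by
  let b := (stdOrthonormalBasis ℝ (Submodule.span ℝ {h})ᗮ).reindex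
    (finCongr (finrank_orthogonal_span h))
  refine ⟨fun i => (b i : E d), fun i => (Submodule.coe_norm (b i)).symm.trans (b.norm_eq_one i), fun g => ?_⟩
  have h1 := b.sum_sq_inner_right ((Submodule.span ℝ {h})ᗮ.orthogonalProjectionOnto g)
  have h2 : ‖perp h g‖ = ‖(Submodule.span ℝ {h})ᗮ.orthogonalProjectionOnto g‖ := rfl
  rw [h2, ← h1]
  refine Finset.sum_congr rfl fun i _ => ?_
  rw [Submodule.coe_inner]
  congr 1
  have := Submodule.inner_starProjection_left_eq_right (Submodule.span ℝ {h})ᗮ (b i : E d) g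
  rw [Submodule.starProjection_eq_self_iff.2 (b i).2] at this
  exact this.symm

section Perturb

variable {θ h : E d} {Δ : ℝ}

theorem lintegral_exp_inner_sq {u : E d} (hu : ‖u‖ = 1) :
    ∫⁻ g, ENNReal.ofReal (Real.exp (⟪u, g⟫ ^ 2 / 4)) ∂(stdGaussian (E d)) =
      ENNReal.ofReal (√2) := by
  rw [← lintegral_exp_sq_gaussianReal, ← stdGaussian_map_inner hu,
    lintegral_map (by fun_prop) (by fun_prop)]

theorem measurable_perturb (h : E d) (Δ : ℝ) :
    Measurable fun g => (Δ / √(effDim h : ℝ)) • perp h g :=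
  (measurable_perp h).const_smul (Δ / √(effDim h : ℝ))

theorem inner_perturb (hθ : perp h θ ≠ 0) (g : E d) :
    ⟪(Δ / √(effDim h : ℝ)) • perp h g, θ⟫ =
      Δ * ‖perp h θ‖ / √(effDim h : ℝ) * ⟪(1 / ‖perp h θ‖) • perp h θ, g⟫ := by
  have : ‖perp h θ‖ ≠ 0 := norm_ne_zero_iff.2 hθ
  rw [real_inner_smul_left, real_inner_smul_left, inner_perp_left]
  field_simp

theorem lintegral_exp_energy_le (hθ : perp h θ ≠ 0) (hΔ : 0 < Δ) :
    ∫⁻ p, ENNReal.ofReal (Real.exp (energy θ h Δ p)) ∂(perturbLaw h Δ) ≤ ENNReal.ofReal (√2) := by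
  have hd : 0 < effDim h := effDim_pos hθ
  have hd' : (0 : ℝ) < effDim h := by exact_mod_cast hd
  have hv : 0 < ‖perp h θ‖ := norm_pos_iff.2 hθ
  obtain ⟨e, he1, he⟩ := exists_norm_perp_sq_eq_sum h
  set u : E d := (1 / ‖perp h θ‖) • perp h θ with hu
  have hu1 : ‖u‖ = 1 := by
    rw [hu, norm_smul, Real.norm_of_nonneg (by positivity), one_div, inv_mul_cancel₀ hv.ne']
  rw [perturbLaw, lintegral_map (by fun_prop) (measurable_perturb h Δ)]
  have hen : ∀ g, energy θ h Δ ((Δ / √(effDim h : ℝ)) • perp h g) =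
      1 / 2 * (∑ i, (1 / (effDim h : ℝ)) * (⟪e i, g⟫ ^ 2 / 4)) + 1 / 2 * (⟪u, g⟫ ^ 2 / 4) := by
    intro g
    rw [energy, inner_perturb hθ, ← hu, norm_smul, mul_pow, he, ← Finset.mul_sum, ← Finset.sum_div,
      Real.norm_of_nonneg (by positivity), div_pow, mul_pow, div_pow, mul_pow,
      Real.sq_sqrt hd'.le]
    field_simp
    ring
  have hconv : ∀ g, Real.exp (energy θ h Δ ((Δ / √(effDim h : ℝ)) • perp h g)) ≤
      1 / 2 * (∑ i, (1 / (effDim h : ℝ)) * Real.exp (⟪e i, g⟫ ^ 2 / 4)) +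
        1 / 2 * Real.exp (⟪u, g⟫ ^ 2 / 4) := by
    intro g
    rw [hen]
    have h1 := convexOn_exp.2
      (Set.mem_univ (∑ i, (1 / (effDim h : ℝ)) * (⟪e i, g⟫ ^ 2 / 4)))
      (Set.mem_univ (⟪u, g⟫ ^ 2 / 4)) (show (0 : ℝ) ≤ 1 / 2 by norm_num)
      (show (0 : ℝ) ≤ 1 / 2 by norm_num) (by norm_num)
    have h2 := convexOn_exp.map_sum_le (t := Finset.univ) (w := fun _ => 1 / (effDim h : ℝ))
      (p := fun i => ⟪e i, g⟫ ^ 2 / 4) (fun _ _ => by positivity)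
      (by simp [hd'.ne']) (fun _ _ => Set.mem_univ _)
    simp only [smul_eq_mul] at h1 h2
    linarith
  calc ∫⁻ g, ENNReal.ofReal
        (Real.exp (energy θ h Δ ((Δ / √(effDim h : ℝ)) • perp h g))) ∂(stdGaussian (E d))
      ≤ ∫⁻ g, (ENNReal.ofReal (1 / 2) * (∑ i, ENNReal.ofReal (1 / (effDim h : ℝ)) *
          ENNReal.ofReal (Real.exp (⟪e i, g⟫ ^ 2 / 4))) +
          ENNReal.ofReal (1 / 2) * ENNReal.ofReal (Real.exp (⟪u, g⟫ ^ 2 / 4)))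
            ∂(stdGaussian (E d)) := by
        refine lintegral_mono fun g => ?_
        refine (ENNReal.ofReal_le_ofReal (hconv g)).trans_eq ?_
        rw [ENNReal.ofReal_add (by positivity) (by positivity), ENNReal.ofReal_mul (by norm_num),
          ENNReal.ofReal_mul (by norm_num), ENNReal.ofReal_sum_of_nonneg fun _ _ => by positivity]
        simp_rw [ENNReal.ofReal_mul (show 0 ≤ 1 / (effDim h : ℝ) by positivity)]
    _ = ENNReal.ofReal (1 / 2) * (∑ _i : Fin (effDim h), ENNReal.ofReal (1 / (effDim h : ℝ)) *
          ENNReal.ofReal (√2)) + ENNReal.ofReal (1 / 2) * ENNReal.ofReal (√2) := by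
        rw [lintegral_add_left (by fun_prop), lintegral_const_mul _ (by fun_prop),
          lintegral_const_mul _ (by fun_prop), lintegral_finsetSum _ (fun _ _ => by fun_prop),
          lintegral_exp_inner_sq hu1]
        congr 2
        refine Finset.sum_congr rfl fun i _ => ?_
        rw [lintegral_const_mul _ (by fun_prop), lintegral_exp_inner_sq (he1 i)]
    _ = ENNReal.ofReal (√2) := by
        have hs : (0 : ℝ) ≤ √2 := by positivity
        simp_rw [← ENNReal.ofReal_mul (show 0 ≤ 1 / (effDim h : ℝ) by positivity)]
        rw [← ENNReal.ofReal_sum_of_nonneg fun _ _ => by positivity,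
          ← ENNReal.ofReal_mul (by norm_num), ← ENNReal.ofReal_mul (by norm_num),
          ← ENNReal.ofReal_add (by positivity) (by positivity)]
        congr 1
        simp only [Finset.sum_const, Finset.card_univ, Fintype.card_fin, nsmul_eq_mul]
        field_simp
        ring

/-- The perturbation is atypical. -/
def atypical (θ h : E d) (Δ : ℝ) (p : E d) : Prop :=
  |⟪p, θ⟫| < 0.09 * (Δ * ‖perp h θ‖ / √(effDim h : ℝ)) ∨
    2.5 * (Δ * ‖perp h θ‖ / √(effDim h : ℝ)) < |⟪p, θ⟫| ∨ 40 * Δ ^ 2 < ‖p‖ ^ 2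

theorem measurableSet_atypical (θ h : E d) (Δ : ℝ) : MeasurableSet {p | atypical θ h Δ p} := by
  unfold atypical
  have h1 : Measurable fun p : E d => |⟪p, θ⟫| := by
    have : Continuous fun p : E d => |⟪p, θ⟫| := by fun_prop
    exact this.measurable
  exact (measurableSet_lt h1 measurable_const).union ((measurableSet_lt measurable_const h1).union
    (measurableSet_lt measurable_const (measurable_norm.pow_const 2)))

theorem exp_five_ge : (142 : ℝ) ≤ Real.exp 5 := by
  have e1 : (2.7 : ℝ) ≤ Real.exp 1 := by
    have := Real.exp_one_gt_d9
    linarith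
  have e2 : Real.exp (5 : ℝ) = Real.exp 1 ^ 5 := by
    rw [← Real.exp_nat_mul]; norm_num
  rw [e2]
  calc (142 : ℝ) ≤ 2.7 ^ 5 := by norm_num
    _ ≤ _ := by gcongr

theorem perturbLaw_atypical_le (hθ : perp h θ ≠ 0) (hΔ : 0 < Δ) :
    perturbLaw h Δ {p | atypical θ h Δ p} ≤ ENNReal.ofReal 0.172 := by
  have hd' : (0 : ℝ) < effDim h := by exact_mod_cast effDim_pos hθ
  have hv : 0 < ‖perp h θ‖ := norm_pos_iff.2 hθ
  set u : E d := (1 / ‖perp h θ‖) • perp h θ with hu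
  have hu1 : ‖u‖ = 1 := by
    rw [hu, norm_smul, Real.norm_of_nonneg (by positivity), one_div, inv_mul_cancel₀ hv.ne']
  set w := Δ * ‖perp h θ‖ / √(effDim h : ℝ) with hw
  have hw0 : 0 < w := by positivity
  have hin : Measurable fun p : E d => |⟪p, θ⟫| := by
    have : Continuous fun p : E d => |⟪p, θ⟫| := by fun_prop
    exact this.measurable
  have habs : ∀ g, |⟪(Δ / √(effDim h : ℝ)) • perp h g, θ⟫| = w * |⟪u, g⟫| := by
    intro g
    rw [inner_perturb hθ, abs_mul, abs_of_pos hw0]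
  have h1 : perturbLaw h Δ {p | |⟪p, θ⟫| < 0.09 * w} ≤ ENNReal.ofReal 0.072 := by
    refine le_of_eq_of_le ?_ gaussianReal_abs_lt_le
    rw [← stdGaussian_map_inner hu1, perturbLaw,
      Measure.map_apply (measurable_perturb h Δ) (measurableSet_lt hin measurable_const),
      Measure.map_apply (by fun_prop) (measurableSet_lt (by fun_prop) measurable_const)]
    congr 1
    ext g
    simp only [Set.mem_preimage, Set.mem_ofPred_eq, habs]
    rw [mul_comm, mul_lt_mul_iff_of_pos_right hw0]
  have h2 : perturbLaw h Δ {p | 2.5 * w < |⟪p, θ⟫|} ≤ ENNReal.ofReal 0.09 := by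
    refine le_of_eq_of_le ?_ gaussianReal_lt_abs_le
    rw [← stdGaussian_map_inner hu1, perturbLaw,
      Measure.map_apply (measurable_perturb h Δ) (measurableSet_lt measurable_const hin),
      Measure.map_apply (by fun_prop) (measurableSet_lt measurable_const (by fun_prop))]
    congr 1
    ext g
    simp only [Set.mem_preimage, Set.mem_ofPred_eq, habs]
    rw [mul_comm w, mul_lt_mul_iff_of_pos_right hw0]
  have h3 : perturbLaw h Δ {p | 40 * Δ ^ 2 < ‖p‖ ^ 2} ≤ ENNReal.ofReal 0.01 := by
    calc perturbLaw h Δ {p | 40 * Δ ^ 2 < ‖p‖ ^ 2}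
        ≤ perturbLaw h Δ {p | ENNReal.ofReal (Real.exp 5) ≤
            ENNReal.ofReal (Real.exp (energy θ h Δ p))} := by
          refine measure_mono fun p hp => ENNReal.ofReal_le_ofReal (Real.exp_le_exp.2 ?_)
          have hp' : 40 * Δ ^ 2 < ‖p‖ ^ 2 := hp
          have e1 : 5 ≤ ‖p‖ ^ 2 / (8 * Δ ^ 2) := by
            rw [le_div_iff₀ (by positivity)]; linarith
          have e2 : 0 ≤ effDim h * ⟪p, θ⟫ ^ 2 / (8 * Δ ^ 2 * ‖perp h θ‖ ^ 2) := by positivity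
          unfold energy
          linarith
      _ ≤ _ := meas_ge_le_lintegral_div (by fun_prop) (by simp [Real.exp_pos]) (by simp)
      _ ≤ ENNReal.ofReal (√2) / ENNReal.ofReal (Real.exp 5) := by
          gcongr
          exact lintegral_exp_energy_le hθ hΔ
      _ ≤ ENNReal.ofReal 0.01 := by
          rw [← ENNReal.ofReal_div_of_pos (Real.exp_pos _)]
          refine ENNReal.ofReal_le_ofReal ?_
          rw [div_le_iff₀ (Real.exp_pos _)]
          have e1 := exp_five_ge
          have e2 : √2 ≤ 1.42 := Real.sqrt_le_iff.2 ⟨by norm_num, by norm_num⟩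
          linarith
  calc perturbLaw h Δ {p | atypical θ h Δ p}
      ≤ perturbLaw h Δ {p | |⟪p, θ⟫| < 0.09 * w} + (perturbLaw h Δ {p | 2.5 * w < |⟪p, θ⟫|} +
        perturbLaw h Δ {p | 40 * Δ ^ 2 < ‖p‖ ^ 2}) :=
        (measure_union_le _ _).trans (add_le_add_right (measure_union_le _ _) _)
    _ ≤ ENNReal.ofReal 0.072 + (ENNReal.ofReal 0.09 + ENNReal.ofReal 0.01) := by gcongr
    _ = ENNReal.ofReal 0.172 := by
        rw [← ENNReal.ofReal_add (by norm_num) (by norm_num),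
          ← ENNReal.ofReal_add (by norm_num) (by norm_num)]
        norm_num

end Perturb

end HintBandit

namespace HintBandit

/-! ### Independence of blocks and product measures -/

open scoped ENNReal

theorem iIndepFun_curry {ι κ X : Type*} [MeasurableSpace X] (ν : ι × κ → Measure X)
    [∀ i, IsProbabilityMeasure (ν i)] :
    iIndepFun (fun i (y : ι × κ → X) j => y (i, j)) (Measure.infinitePi ν) := by
  rw [iIndepFun_iff_map_fun_eq_infinitePi_map (by fun_prop)]
  refine (Measure.infinitePi_map_curry fun i j => ν (i, j)).trans ?_
  congr 1
  ext1 i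
  exact (Measure.map_infinitePi_infinitePi_of_inj (P := ν) (f := fun j => (i, j))
    (fun a b hab => (Prod.mk.inj hab).2)).symm

theorem lintegral_pi_prod {k : ℕ} {α : Type*} [MeasurableSpace α] (P : Fin k → Measure α)
    [∀ i, IsProbabilityMeasure (P i)] {f : Fin k → α → ℝ≥0∞} (hf : ∀ i, Measurable (f i)) :
    ∫⁻ x, ∏ i, f i (x i) ∂(Measure.pi P) = ∏ i, ∫⁻ x, f i x ∂(P i) := by
  rw [← Measure.infinitePi_eq_pi]
  refine (lintegral_prod_eq_prod_lintegral_of_indepFun Finset.univ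
    (fun i (x : Fin k → α) => f i (x i))
    (iIndepFun_infinitePi hf) (fun i => (hf i).comp (measurable_pi_apply i))).trans ?_
  refine Finset.prod_congr rfl fun i _ => ?_
  rw [← lintegral_map (hf i) (measurable_pi_apply i), Measure.infinitePi_map_eval]

theorem lintegral_prod_pi_le {k : ℕ} {α β : Type*} [MeasurableSpace α] [MeasurableSpace β]
    (P : Measure α) [IsProbabilityMeasure P] (ρ : Fin k → Measure β)
    [∀ i, IsProbabilityMeasure (ρ i)] {f : α → ℝ≥0∞} {g : α × β → ℝ≥0∞} (hf : Measurable f)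
    (hg : Measurable g) {a b : ℝ≥0∞} (ha : ∫⁻ x, f x ∂P ≤ a)
    (hb : ∀ x i, ∫⁻ y, g (x, y) ∂(ρ i) ≤ b) :
    ∫⁻ z, ∏ i, (f (z.1 i) * g (z.1 i, z.2 i)) ∂((Measure.pi fun _ : Fin k => P).prod
      (Measure.pi ρ)) ≤ (a * b) ^ k := by
  rw [lintegral_prod _ (by fun_prop)]
  calc ∫⁻ x, ∫⁻ y, ∏ i, (f (x i) * g (x i, y i)) ∂(Measure.pi ρ) ∂(Measure.pi fun _ : Fin k => P)
      = ∫⁻ x, ∏ i, ∫⁻ y, f (x i) * g (x i, y) ∂(ρ i) ∂(Measure.pi fun _ : Fin k => P) := by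
        refine lintegral_congr fun x => ?_
        exact lintegral_pi_prod ρ (f := fun i y => f (x i) * g (x i, y)) (fun i => by fun_prop)
    _ ≤ ∫⁻ x, ∏ i, (f (x i) * b) ∂(Measure.pi fun _ : Fin k => P) := by
        refine lintegral_mono fun x => Finset.prod_le_prod' fun i _ => ?_
        rw [lintegral_const_mul _ (by fun_prop)]
        gcongr
        exact hb _ _
    _ = ∏ _i : Fin k, ∫⁻ x, f x * b ∂P := lintegral_pi_prod _ (f := fun _ x => f x * b)
        (fun i => by fun_prop)
    _ ≤ (a * b) ^ k := by
        rw [Finset.prod_const, Finset.card_univ, Fintype.card_fin, lintegral_mul_const _ hf]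
        gcongr

theorem lintegral_one_add_indicator_le {α : Type*} [MeasurableSpace α] (P : Measure α)
    [IsProbabilityMeasure P] {s : Set α} (hs : MeasurableSet s) {q : ℝ} (hq : 0 ≤ q)
    (h : P s ≤ ENNReal.ofReal q) :
    ∫⁻ x, (1 + s.indicator (fun _ => ENNReal.ofReal (1 / 2)) x) ∂P ≤
      ENNReal.ofReal (1 + q / 2) := by
  rw [lintegral_add_left measurable_const, lintegral_indicator_const hs, lintegral_const,
    measure_univ, ENNReal.ofReal_add zero_le_one (by positivity), ENNReal.ofReal_one, mul_one]
  gcongr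
  calc _ ≤ ENNReal.ofReal (1 / 2) * ENNReal.ofReal q := by gcongr
    _ = _ := by rw [← ENNReal.ofReal_mul (by norm_num)]; ring_nf

/-! ### The noise of one instance -/

variable {d : ℕ}

/-- The noise of the difference `x̄_n` of an instance with perturbation `p` leaves its
confidence band at some time. -/
def noisy (h p : E d) (y : ℕ × Bool → ℝ) : Prop :=
  escapes (1 + ‖h‖ ^ 2 + ‖p‖ ^ 2) fun n => √(‖p‖ ^ 2 + ‖h‖ ^ 2) * y (n, true) - y (n, false)

theorem measurableSet_noisy (h : E d) :
    MeasurableSet {z : E d × (ℕ × Bool → ℝ) | noisy h z.1 z.2} := by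
  have : {z : E d × (ℕ × Bool → ℝ) | noisy h z.1 z.2} = ⋃ n : ℕ, {z | 1 ≤ n ∧
      √(3 * (1 + ‖h‖ ^ 2 + ‖z.1‖ ^ 2) * Real.log (40 * Real.log (2 * n)) * n) <
      |∑ i ∈ Finset.range n, (√(‖z.1‖ ^ 2 + ‖h‖ ^ 2) * z.2 (i, true) - z.2 (i, false))|} := by
    ext z
    simp [noisy, escapes]
  rw [this]
  refine MeasurableSet.iUnion fun n => (MeasurableSet.const _).inter ?_
  have h1 : Measurable fun z : E d × (ℕ × Bool → ℝ) =>
      √(3 * (1 + ‖h‖ ^ 2 + ‖z.1‖ ^ 2) * Real.log (40 * Real.log (2 * n)) * n) := by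
    fun_prop
  have h2 : Measurable fun z : E d × (ℕ × Bool → ℝ) =>
      ∑ i ∈ Finset.range n, (√(‖z.1‖ ^ 2 + ‖h‖ ^ 2) * z.2 (i, true) - z.2 (i, false)) := by
    fun_prop
  exact measurableSet_lt h1 h2.abs

theorem measure_noisy_le (h p : E d) (ν : ℕ × Bool → Measure ℝ) [∀ i, IsProbabilityMeasure (ν i)]
    (hν : ∀ i, HasSubgaussianMGF id 1 (ν i)) :
    Measure.infinitePi ν {y | noisy h p y} ≤ ENNReal.ofReal 0.062 := by
  set w := √(‖p‖ ^ 2 + ‖h‖ ^ 2) with hw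
  let s : NNReal := ⟨w ^ 2, sq_nonneg w⟩ * 1 + 1
  have hs : (s : ℝ) = 1 + ‖h‖ ^ 2 + ‖p‖ ^ 2 := by
    have : w ^ 2 = ‖p‖ ^ 2 + ‖h‖ ^ 2 := Real.sq_sqrt (by positivity)
    have h1 : (s : ℝ) = w ^ 2 * 1 + 1 := rfl
    rw [h1, this]
    ring
  have hsub : ∀ i, HasSubgaussianMGF (fun y : ℕ × Bool → ℝ => y i) 1 (Measure.infinitePi ν) := by
    intro i
    refine HasSubgaussianMGF.of_map (X := id) (measurable_pi_apply i).aemeasurable ?_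
    rw [Measure.infinitePi_map_eval]
    exact hν i
  have hcoord : iIndepFun (fun i (y : ℕ × Bool → ℝ) => y i) (Measure.infinitePi ν) :=
    iIndepFun_infinitePi (X := fun _ x => x) (fun _ => measurable_id)
  have hφ : Measurable fun b : Bool → ℝ => w * b true - b false := by fun_prop
  have key := measure_escapes_le (μ := Measure.infinitePi ν) (s := s)
    (η := fun n y => w * y (n, true) - y (n, false)) (by positivity) (fun n => by fun_prop)
    ((iIndepFun_curry ν).comp (fun _ b => w * b true - b false) (fun _ => hφ))
    (fun n => ((hsub (n, true)).const_mul w).sub_of_indepFun (hsub (n, false))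
      ((hcoord.indepFun (i := (n, true)) (j := (n, false)) (by simp)).comp
        (measurable_const_mul w) measurable_id))
  rw [hs] at key
  exact key

/-! ### Typical runs -/

/-- At most `0.33 k` instances have an atypical perturbation or a noise outside of its confidence
band, and the perturbations have bounded total energy. -/
def TypicalRun {k : ℕ} (θ h : E d) (Δ : ℝ) (p : Fin k → E d) (ξ : Fin k × ℕ × Bool → ℝ) : Prop :=
  (∃ B : Finset (Fin k), (B.card : ℝ) ≤ 0.33 * k ∧
    ∀ i ∉ B, ¬ atypical θ h Δ (p i) ∧ ¬ noisy h (p i) (fun j => ξ (i, j))) ∧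
  ∑ i, energy θ h Δ (p i) ≤ 5 * k

theorem pow_le_pow_of_le {k m : ℕ} (h : 33 * k ≤ 100 * m) : (1.14 : ℝ) ^ k ≤ 1.5 ^ m := by
  refine le_of_pow_le_pow_left₀ (n := 100) (by norm_num) (by positivity) ?_
  calc ((1.14 : ℝ) ^ k) ^ 100 = (1.14 ^ 100) ^ k := by rw [← pow_mul, ← pow_mul, mul_comm]
    _ ≤ (1.5 ^ 33) ^ k := by gcongr; norm_num
    _ = 1.5 ^ (33 * k) := by rw [← pow_mul]
    _ ≤ 1.5 ^ (100 * m) := by gcongr; norm_num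
    _ = (1.5 ^ m) ^ 100 := by rw [← pow_mul, mul_comm]

section Canonical

variable {k : ℕ} {θ h : E d} {Δ : ℝ} (ν : Fin k × ℕ × Bool → Measure ℝ)
  [∀ i, IsProbabilityMeasure (ν i)]

instance isProbabilityMeasure_perturbLaw (h : E d) (Δ : ℝ) :
    IsProbabilityMeasure (perturbLaw h Δ) :=
  Measure.isProbabilityMeasure_map (measurable_perturb h Δ).aemeasurable

/-- The joint law of the perturbations and the noise variables, grouped by instances. -/
noncomputable def jointLaw (h : E d) (Δ : ℝ) :
    Measure ((Fin k → E d) × (Fin k → (ℕ × Bool → ℝ))) :=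
  (Measure.pi fun _ => perturbLaw h Δ).prod
    (Measure.pi fun i => Measure.infinitePi fun j => ν (i, j))

instance : IsProbabilityMeasure (jointLaw ν h Δ) := by
  unfold jointLaw; infer_instance

open Classical in
theorem jointLaw_many_bad_le (hν : ∀ i, HasSubgaussianMGF id 1 (ν i)) (hθ : perp h θ ≠ 0)
    (hΔ : 0 < Δ) :
    jointLaw ν h Δ {z | 0.33 * (k : ℝ) < (Finset.univ.filter fun i =>
      atypical θ h Δ (z.1 i) ∨ noisy h (z.1 i) (z.2 i)).card} ≤ ENNReal.ofReal (0.985 ^ k) := by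
  let f : E d → ℝ≥0∞ := fun x =>
    1 + {p | atypical θ h Δ p}.indicator (fun _ => ENNReal.ofReal (1 / 2)) x
  let g : E d × (ℕ × Bool → ℝ) → ℝ≥0∞ := fun x =>
    1 + {z | noisy h z.1 z.2}.indicator (fun _ => ENNReal.ofReal (1 / 2)) x
  have hf : Measurable f :=
    (measurable_const.indicator (measurableSet_atypical θ h Δ)).const_add 1
  have hg : Measurable g :=
    (measurable_const.indicator (measurableSet_noisy h)).const_add 1
  have hint := lintegral_prod_pi_le (perturbLaw h Δ)
    (fun i : Fin k => Measure.infinitePi fun j => ν (i, j)) hf hg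
    (lintegral_one_add_indicator_le _ (measurableSet_atypical θ h Δ) (by norm_num)
      (perturbLaw_atypical_le hθ hΔ))
    (fun x i => lintegral_one_add_indicator_le _
      (measurable_prodMk_left (x := x) (measurableSet_noisy h)) (by norm_num)
      (measure_noisy_le h x (fun j => ν (i, j)) fun j => hν (i, j)))
  rw [← ENNReal.ofReal_mul (by norm_num), ← ENNReal.ofReal_pow (by norm_num)] at hint
  have hone : (1 : ℝ≥0∞) + ENNReal.ofReal (1 / 2) = ENNReal.ofReal 1.5 := by
    rw [← ENNReal.ofReal_one, ← ENNReal.ofReal_add (by norm_num) (by norm_num)]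
    norm_num
  have hf1 : ∀ x, 1 ≤ f x := fun x => le_self_add
  have hg1 : ∀ x, 1 ≤ g x := fun x => le_self_add
  have hfB : ∀ x, atypical θ h Δ x → f x = ENNReal.ofReal 1.5 := by
    intro x hx
    rw [← hone, ← Set.indicator_of_mem (s := {p | atypical θ h Δ p}) hx
      fun _ => ENNReal.ofReal (1 / 2)]
  have hgB : ∀ x : E d × (ℕ × Bool → ℝ), noisy h x.1 x.2 → g x = ENNReal.ofReal 1.5 := by
    intro x hx
    rw [← hone, ← Set.indicator_of_mem (s := {z : E d × (ℕ × Bool → ℝ) | noisy h z.1 z.2}) hx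
      fun _ => ENNReal.ofReal (1 / 2)]
  clear_value f g
  have hmeas : Measurable fun z : (Fin k → E d) × (Fin k → (ℕ × Bool → ℝ)) =>
      ∏ i, (f (z.1 i) * g (z.1 i, z.2 i)) := by fun_prop
  have hpos : (0 : ℝ) < 1.14 ^ k := by positivity
  have hmarkov := meas_ge_le_lintegral_div (μ := jointLaw ν h Δ) hmeas.aemeasurable
    (ENNReal.ofReal_pos.2 hpos).ne' ENNReal.ofReal_ne_top
  calc _ ≤ jointLaw ν h Δ {z | ENNReal.ofReal (1.14 ^ k) ≤
          ∏ i, (f (z.1 i) * g (z.1 i, z.2 i))} := by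
        refine measure_mono fun z hz => ?_
        set B := Finset.univ.filter fun i => atypical θ h Δ (z.1 i) ∨ noisy h (z.1 i) (z.2 i)
          with hB
        have hz' : 0.33 * (k : ℝ) < B.card := hz
        have hnat : 33 * k ≤ 100 * B.card := by
          have : (33 * k : ℝ) ≤ 100 * B.card := by linarith
          exact_mod_cast this
        calc ENNReal.ofReal (1.14 ^ k) ≤ ENNReal.ofReal (1.5 ^ B.card) :=
              ENNReal.ofReal_le_ofReal (pow_le_pow_of_le hnat)
          _ = ∏ i ∈ B, ENNReal.ofReal 1.5 := by
              rw [Finset.prod_const, ENNReal.ofReal_pow (by norm_num)]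
          _ ≤ ∏ i ∈ B, (f (z.1 i) * g (z.1 i, z.2 i)) := by
              refine Finset.prod_le_prod' fun i hi => ?_
              rcases (Finset.mem_filter.1 hi).2 with h1 | h1
              · rw [hfB _ h1]
                exact le_mul_of_one_le_right' (hg1 _)
              · rw [hgB (z.1 i, z.2 i) h1]
                exact le_mul_of_one_le_left' (hf1 _)
          _ ≤ ∏ i, (f (z.1 i) * g (z.1 i, z.2 i)) :=
              Finset.prod_le_prod_of_subset_of_one_le' (Finset.subset_univ _)
                fun i _ _ => one_le_mul (hf1 _) (hg1 _)
    _ ≤ _ := hmarkov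
    _ ≤ ENNReal.ofReal (((1 + 0.172 / 2) * (1 + 0.062 / 2)) ^ k) / ENNReal.ofReal (1.14 ^ k) :=
        ENNReal.div_le_div_right hint _
    _ ≤ ENNReal.ofReal (0.985 ^ k) := by
        rw [← ENNReal.ofReal_div_of_pos hpos, ← div_pow]
        refine ENNReal.ofReal_le_ofReal ?_
        gcongr
        norm_num

theorem jointLaw_energy_le (hθ : perp h θ ≠ 0) (hΔ : 0 < Δ) :
    jointLaw ν h Δ {z | 5 * (k : ℝ) < ∑ i, energy θ h Δ (z.1 i)} ≤ ENNReal.ofReal (0.01 ^ k) := by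
  have hint := lintegral_prod_pi_le (perturbLaw h Δ)
    (fun i : Fin k => Measure.infinitePi fun j => ν (i, j))
    (f := fun p => ENNReal.ofReal (Real.exp (energy θ h Δ p))) (g := fun _ => 1)
    (by fun_prop) measurable_const (lintegral_exp_energy_le hθ hΔ) (b := 1) (fun x i => by simp)
  simp only [mul_one] at hint
  rw [← ENNReal.ofReal_pow (by positivity)] at hint
  calc _ ≤ jointLaw ν h Δ {z | ENNReal.ofReal (Real.exp 5 ^ k) ≤
          ∏ i, ENNReal.ofReal (Real.exp (energy θ h Δ (z.1 i)))} := by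
        refine measure_mono fun z hz => ?_
        have hz' : 5 * (k : ℝ) < ∑ i, energy θ h Δ (z.1 i) := hz
        rw [Set.mem_ofPred_eq, ← ENNReal.ofReal_prod_of_nonneg fun _ _ => (Real.exp_pos _).le, ← Real.exp_sum,
          ← Real.exp_nat_mul]
        refine ENNReal.ofReal_le_ofReal (Real.exp_le_exp.2 ?_)
        linarith
    _ ≤ _ := meas_ge_le_lintegral_div (by fun_prop) (by simp; positivity) (by simp)
    _ ≤ ENNReal.ofReal (√2 ^ k) / ENNReal.ofReal (Real.exp 5 ^ k) := by
        gcongr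
        exact hint
    _ ≤ ENNReal.ofReal (0.01 ^ k) := by
        rw [← ENNReal.ofReal_div_of_pos (by positivity), ← div_pow]
        refine ENNReal.ofReal_le_ofReal ?_
        gcongr
        rw [div_le_iff₀ (Real.exp_pos _)]
        have e1 := exp_five_ge
        have e2 : √2 ≤ 1.42 := Real.sqrt_le_iff.2 ⟨by norm_num, by norm_num⟩
        linarith

end Canonical

theorem one_le_numInstances {δ : ℝ} (h0 : 0 < δ) (h1 : δ < 1) : 1 ≤ numInstances δ := by
  have : 0 < Real.log (1 / δ) := Real.log_pos (by rw [lt_div_iff₀ h0]; linarith)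
  exact Nat.ceil_pos.2 (by positivity)

theorem add_pow_numInstances_le {δ : ℝ} (h0 : 0 < δ) (h1 : δ < 1) :
    (0.985 : ℝ) ^ numInstances δ + 0.01 ^ numInstances δ ≤ δ := by
  set k := numInstances δ with hk
  have hk1 : 1 ≤ k := one_le_numInstances h0 h1
  obtain ⟨m, hm⟩ : ∃ m, k = m + 1 := ⟨k - 1, by omega⟩
  have h2 : (0.985 : ℝ) ^ k + 0.01 ^ k ≤ 0.995 ^ k := by
    rw [hm]
    calc (0.985 : ℝ) ^ (m + 1) + 0.01 ^ (m + 1) = 0.985 ^ m * 0.985 + 0.01 ^ m * 0.01 := by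
          rw [pow_succ, pow_succ]
      _ ≤ 0.995 ^ m * 0.985 + 0.995 ^ m * 0.01 := by gcongr <;> norm_num
      _ = 0.995 ^ (m + 1) := by ring
  have h3 : (0.995 : ℝ) ≤ Real.exp (-(1 / 560)) := by
    have := Real.add_one_le_exp (-(1 / 560 : ℝ))
    linarith
  have h4 : 560 * Real.log (1 / δ) ≤ k := Nat.le_ceil _
  calc _ ≤ (0.995 : ℝ) ^ k := h2
    _ ≤ Real.exp (-(1 / 560)) ^ k := by gcongr
    _ = Real.exp (-(k / 560)) := by rw [← Real.exp_nat_mul]; ring_nf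
    _ ≤ Real.exp (Real.log δ) := by
        refine Real.exp_le_exp.2 ?_
        rw [one_div, Real.log_inv] at h4
        linarith
    _ = δ := Real.exp_log h0

theorem measureReal_typicalRun_ge {k : ℕ} {θ h : E d} {Δ δ : ℝ} (hΔ : 0 < Δ) (h0 : 0 < δ)
    (hk : (0.985 : ℝ) ^ k + 0.01 ^ k ≤ δ) (hθ : perp h θ ≠ 0) {Ω : Type*} [MeasurableSpace Ω] {μ : Measure Ω} [IsProbabilityMeasure μ]
    {p : Fin k → Ω → E d} {ξ : Fin k × ℕ × Bool → Ω → ℝ}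
    (hp : ∀ i, HasLaw (p i) (perturbLaw h Δ) μ) (hpi : iIndepFun p μ)
    (hξ : ∀ j, HasSubgaussianMGF (ξ j) 1 μ) (hξi : iIndepFun ξ μ)
    (hpξ : IndepFun (fun ω i => p i ω) (fun ω j => ξ j ω) μ) {G : Set Ω}
    (hG : ∀ ω, TypicalRun θ h Δ (fun i => p i ω) (fun j => ξ j ω) → ω ∈ G) :
    1 - δ ≤ μ.real G := by
  classical
  let ν : Fin k × ℕ × Bool → Measure ℝ := fun j => μ.map (ξ j)
  have hξm : ∀ j, AEMeasurable (ξ j) μ := fun j => (hξ j).aemeasurable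
  have : ∀ j, IsProbabilityMeasure (ν j) := fun j => Measure.isProbabilityMeasure_map (hξm j)
  have hν : ∀ j, HasSubgaussianMGF id 1 (ν j) := fun j =>
    (HasSubgaussianMGF.id_map_iff (hξm j)).2 (hξ j)
  have hpm : AEMeasurable (fun ω i => p i ω) μ := aemeasurable_pi_iff.2 fun i => (hp i).aemeasurable
  have hξm' : AEMeasurable (fun ω j => ξ j ω) μ := aemeasurable_pi_iff.2 hξm
  let c : (Fin k × ℕ × Bool → ℝ) → Fin k → ℕ × Bool → ℝ := fun x i j => x (i, j)
  have hc : Measurable c := by fun_prop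
  let T : Ω → (Fin k → E d) × (Fin k → ℕ × Bool → ℝ) := fun ω =>
    (fun i => p i ω, c fun j => ξ j ω)
  have hT : AEMeasurable T μ := hpm.prodMk (hc.comp_aemeasurable hξm')
  have hlaw : μ.map T = jointLaw ν h Δ := by
    have h2 : IndepFun (fun ω i => p i ω) (fun ω => c fun j => ξ j ω) μ :=
      hpξ.comp measurable_id hc
    have h3 := (indepFun_iff_map_prod_eq_prod_map_map hpm (hc.comp_aemeasurable hξm')).1 h2
    refine h3.trans ?_
    unfold jointLaw
    congr 1
    · rw [(iIndepFun_iff_map_fun_eq_pi_map fun i => (hp i).aemeasurable).1 hpi]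
      congr 1
      ext1 i
      exact (hp i).map_eq
    · have h4 := (iIndepFun_iff_map_fun_eq_infinitePi_map₀' hξm).1 hξi
      have h5 : μ.map (fun ω => c fun j => ξ j ω) = (μ.map fun ω j => ξ j ω).map c :=
        (AEMeasurable.map_map_of_aemeasurable hc.aemeasurable hξm').symm
      refine h5.trans ?_
      rw [h4, ← Measure.infinitePi_eq_pi]
      exact Measure.infinitePi_map_curry fun i j => ν (i, j)
  let A : Set ((Fin k → E d) × (Fin k → ℕ × Bool → ℝ)) :=
    {z | 0.33 * (k : ℝ) < (Finset.univ.filter fun i =>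
      atypical θ h Δ (z.1 i) ∨ noisy h (z.1 i) (z.2 i)).card}
  let A' : Set ((Fin k → E d) × (Fin k → ℕ × Bool → ℝ)) :=
    {z | 5 * (k : ℝ) < ∑ i, energy θ h Δ (z.1 i)}
  have hbad : Gᶜ ⊆ T ⁻¹' (A ∪ A') := by
    intro ω hω
    by_contra hcon
    refine hω (hG ω ?_)
    have h6 := fun h => hcon (Or.inl h)
    have h7 := fun h => hcon (Or.inr h)
    refine ⟨⟨_, not_lt.1 h6, fun i hi => ?_⟩, not_lt.1 h7⟩
    simp only [Finset.mem_filter, Finset.mem_univ, true_and, not_or] at hi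
    exact hi
  have hle : μ Gᶜ ≤ ENNReal.ofReal δ := by
    calc μ Gᶜ ≤ μ (T ⁻¹' (A ∪ A')) := measure_mono hbad
      _ ≤ μ.map T (A ∪ A') := Measure.le_map_apply hT _
      _ = jointLaw ν h Δ (A ∪ A') := by rw [hlaw]
      _ ≤ jointLaw ν h Δ A + jointLaw ν h Δ A' := measure_union_le _ _
      _ ≤ ENNReal.ofReal (0.985 ^ k) + ENNReal.ofReal (0.01 ^ k) :=
          add_le_add (jointLaw_many_bad_le ν hν hθ hΔ) (jointLaw_energy_le ν hθ hΔ)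
      _ ≤ ENNReal.ofReal δ := by
          rw [← ENNReal.ofReal_add (by positivity) (by positivity)]
          exact ENNReal.ofReal_le_ofReal hk
  have hreal : μ.real Gᶜ ≤ δ := ENNReal.toReal_le_of_le_ofReal h0.le hle
  have huniv : (1 : ℝ) ≤ μ.real G + μ.real Gᶜ := by
    have := measureReal_union_le (μ := μ) G Gᶜ
    rwa [Set.union_compl_self, probReal_univ] at this
  linarith

end HintBandit

namespace HintBandit

/-! ### One typical instance -/

section Instance

variable {d : ℕ} {θ h p : E d} {Δ : ℝ} {y : ℕ × Bool → ℝ}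

theorem avgDiff_eq (θ h p : E d) (ξ : ℕ → Bool → ℝ) {n : ℕ} (hn : 1 ≤ n) :
    avgDiff θ h p ξ n = ⟪p, θ⟫ +
      (∑ j ∈ Finset.range n, (√(‖p‖ ^ 2 + ‖h‖ ^ 2) * ξ j true - ξ j false)) / n := by
  set w := √(‖p‖ ^ 2 + ‖h‖ ^ 2) with hw
  have hn0 : (n : ℝ) ≠ 0 := by positivity
  have hkey : w * ⟪perturbedAction h p, θ⟫ = ⟪h, θ⟫ + ⟪p, θ⟫ := by
    rw [perturbedAction, ← hw, real_inner_smul_left, inner_add_left]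
    rcases eq_or_ne w 0 with h0 | h0
    · have h1 : ‖p‖ ^ 2 + ‖h‖ ^ 2 = 0 := (Real.sqrt_eq_zero (by positivity)).1 (hw ▸ h0)
      have h2 : p = 0 := by
        rw [← norm_eq_zero, ← sq_eq_zero_iff]; nlinarith [sq_nonneg ‖p‖, sq_nonneg ‖h‖]
      have h3 : h = 0 := by
        rw [← norm_eq_zero, ← sq_eq_zero_iff]; nlinarith [sq_nonneg ‖p‖, sq_nonneg ‖h‖]
      simp [h2, h3]
    · field_simp
  rw [avgDiff, avgReward, avgReward, ← hw]
  simp only [Finset.sum_add_distrib, Finset.sum_sub_distrib, Finset.sum_const, Finset.card_range,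
    nsmul_eq_mul, ← Finset.mul_sum]
  have : ⟪p, θ⟫ = w * ⟪perturbedAction h p, θ⟫ - ⟪h, θ⟫ := by linarith
  rw [this]
  field_simp
  ring

theorem abs_avgDiff_sub_le (hy : ¬ noisy h p y) {n : ℕ} (hn : 1 ≤ n) :
    |avgDiff θ h p (fun j b => y (j, b)) n - ⟪p, θ⟫| ≤ width h p n := by
  have hn0 : (0 : ℝ) < n := by positivity
  rw [avgDiff_eq θ h p _ hn, add_sub_cancel_left, abs_div, abs_of_pos hn0, div_le_iff₀ hn0]
  have h1 : |∑ i ∈ Finset.range n, (√(‖p‖ ^ 2 + ‖h‖ ^ 2) * y (i, true) - y (i, false))| ≤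
      √(3 * (1 + ‖h‖ ^ 2 + ‖p‖ ^ 2) * Real.log (40 * Real.log (2 * n)) * n) := by
    by_contra! hcon
    exact hy ⟨n, hn, hcon⟩
  refine h1.trans_eq ?_
  set x := 3 * (1 + ‖h‖ ^ 2 + ‖p‖ ^ 2) * Real.log (40 * Real.log (2 * n)) with hx
  rw [width, ← hx]
  rw [show x * n = x / n * n ^ 2 by field_simp, Real.sqrt_mul' _ (by positivity),
    Real.sqrt_sq hn0.le]

theorem effDim_le (h : E d) : effDim h ≤ d := by
  unfold effDim; split_ifs <;> omega

theorem instValue_mem (hθ : perp h θ ≠ 0) (hΔ : 0 < Δ) (hp : ¬ atypical θ h Δ p)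
    (hy : ¬ noisy h p y) {n : ℕ} (hn : 1 ≤ n)
    (hr : instReturns θ h p (fun j b => y (j, b)) n) :
    0.06 * ‖perp h θ‖ ≤ instValue θ h Δ p (fun j b => y (j, b)) n ∧
      instValue θ h Δ p (fun j b => y (j, b)) n ≤ 5 * ‖perp h θ‖ := by
  have hd : (0 : ℝ) < effDim h := by exact_mod_cast effDim_pos hθ
  have hd' : 0 < √(effDim h : ℝ) := Real.sqrt_pos.2 hd
  simp only [atypical, not_or, not_lt] at hp
  obtain ⟨h1, h2, -⟩ := hp
  have h3 := abs_avgDiff_sub_le (θ := θ) hy hn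
  have h4 : 2 * width h p n ≤ |avgDiff θ h p (fun j b => y (j, b)) n| := hr
  unfold instValue
  set x := avgDiff θ h p (fun j b => y (j, b)) n
  have h5 := abs_sub_abs_le_abs_sub x ⟪p, θ⟫
  have h6 := abs_sub_abs_le_abs_sub ⟪p, θ⟫ x
  rw [abs_sub_comm] at h6
  have e : ∀ c : ℝ, √(effDim h : ℝ) / Δ * (c * (Δ * ‖perp h θ‖ / √(effDim h : ℝ))) =
      c * ‖perp h θ‖ := by
    intro c; field_simp
  constructor
  · rw [← e]
    gcongr
    linarith
  · rw [← e]
    gcongr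
    linarith

theorem instReturns_of_le (hθ : perp h θ ≠ 0) (hΔ : 0 < Δ) (hp : ¬ atypical θ h Δ p)
    (hy : ¬ noisy h p y) {n : ℕ} (hn : 1 ≤ n)
    (hX : 133334 * scale θ h Δ * Real.log (40 * Real.log (2 * n)) ≤ n) :
    instReturns θ h p (fun j b => y (j, b)) n := by
  have hd : (0 : ℝ) < effDim h := by exact_mod_cast effDim_pos hθ
  have hdd : (effDim h : ℝ) ≤ d := by exact_mod_cast effDim_le h
  have hv : 0 < ‖perp h θ‖ := norm_pos_iff.2 hθ
  have hn0 : (0 : ℝ) < n := by positivity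
  simp only [atypical, not_or, not_lt] at hp
  obtain ⟨h1, -, h2⟩ := hp
  have h3 := abs_avgDiff_sub_le (θ := θ) hy hn
  have h6 := abs_sub_abs_le_abs_sub ⟪p, θ⟫ (avgDiff θ h p (fun j b => y (j, b)) n)
  rw [abs_sub_comm] at h6
  have hΛ : 0 ≤ Real.log (40 * Real.log (2 * n)) := by
    have := le_log_mul_log (j := 0) (n := n) (by simpa using hn)
    exact (Real.log_nonneg (by norm_num)).trans this
  set Λ := Real.log (40 * Real.log (2 * n)) with hΛdef
  have key : width h p n ≤ 0.03 * (Δ * ‖perp h θ‖ / √(effDim h : ℝ)) := by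
    unfold width
    refine Real.sqrt_le_iff.2 ⟨by positivity, ?_⟩
    rw [← hΛdef, mul_pow, div_pow, Real.sq_sqrt hd.le, div_le_iff₀ hn0]
    rw [scale, mul_div_assoc', div_mul_eq_mul_div, div_le_iff₀ (by positivity)] at hX
    rw [mul_div_assoc', div_mul_eq_mul_div, le_div_iff₀ hd, mul_pow]
    have hs : 1 + ‖h‖ ^ 2 + ‖p‖ ^ 2 ≤ 40 * (1 + Δ ^ 2 + ‖h‖ ^ 2) := by
      nlinarith [sq_nonneg ‖h‖]
    calc 3 * (1 + ‖h‖ ^ 2 + ‖p‖ ^ 2) * Λ * effDim h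
        ≤ 3 * (40 * (1 + Δ ^ 2 + ‖h‖ ^ 2)) * Λ * d := by gcongr
      _ = 120 * ((d : ℝ) * (1 + Δ ^ 2 + ‖h‖ ^ 2) * Λ) := by ring
      _ ≤ 0.03 ^ 2 * (133334 * ((d : ℝ) * (1 + Δ ^ 2 + ‖h‖ ^ 2)) * Λ) := by
          have : 0 ≤ (d : ℝ) * (1 + Δ ^ 2 + ‖h‖ ^ 2) * Λ := by positivity
          linarith
      _ ≤ 0.03 ^ 2 * (n * (Δ ^ 2 * ‖perp h θ‖ ^ 2)) := by gcongr
      _ = 0.03 ^ 2 * (Δ ^ 2 * ‖perp h θ‖ ^ 2) * n := by ring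
  unfold instReturns
  linarith

end Instance

/-! ### The number of calls -/

theorem one_le_logFactor {X : ℝ} (hX : 0 ≤ X) : 1 ≤ logFactor X := by
  have h1 : 0 ≤ Real.log (1 + X) := Real.log_nonneg (by linarith)
  rw [logFactor, Real.le_log_iff_exp_le (by positivity)]
  linarith

theorem logFactor_le {X : ℝ} (hX : 0 ≤ X) : logFactor X ≤ 1 + X := by
  have h1 : 0 ≤ Real.log (1 + X) := Real.log_nonneg (by linarith)
  have h2 : Real.log (1 + X) ≤ X := by
    have := Real.log_le_sub_one_of_pos (show 0 < 1 + X by linarith)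
    linarith
  have h3 := Real.add_one_le_exp X
  have h4 := Real.add_one_le_exp 1
  rw [logFactor, Real.log_le_iff_le_exp (by positivity), Real.exp_add]
  nlinarith [mul_le_mul_of_nonneg_left h3 (Real.exp_pos 1).le, mul_nonneg hX hX]

theorem log_mul_log_le {X : ℝ} (hX : 0 ≤ X) {n : ℕ} (hn : 1 ≤ n)
    (hnX : (n : ℝ) ≤ 1 + 2 ^ 23 * X * logFactor X) :
    Real.log (40 * Real.log (2 * n)) ≤ 8 * logFactor X := by
  have h0 : 0 ≤ Real.log (1 + X) := Real.log_nonneg (by linarith)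
  have hl := one_le_logFactor hX
  have hn1 : (1 : ℝ) ≤ n := by exact_mod_cast hn
  have h1 : 2 * (n : ℝ) ≤ 2 ^ 24 * (1 + X) ^ 2 := by
    have := mul_le_mul_of_nonneg_left (logFactor_le hX) hX
    nlinarith
  have hlog2 : 0 < Real.log (2 * n) := Real.log_pos (by linarith)
  have h2 : Real.log (2 * n) ≤ 17 * (Real.exp 1 + Real.log (1 + X)) := by
    calc Real.log (2 * n) ≤ Real.log (2 ^ 24 * (1 + X) ^ 2) :=
          Real.log_le_log (by positivity) h1
      _ = 24 * Real.log 2 + 2 * Real.log (1 + X) := by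
          rw [Real.log_mul (by positivity) (by positivity), Real.log_pow, Real.log_pow]
          push_cast
          ring
      _ ≤ _ := by
          have := Real.log_two_lt_d9
          have := Real.add_one_le_exp 1
          linarith
  have h3 : (680 : ℝ) ≤ Real.exp 7 := by
    have e2 : Real.exp (7 : ℝ) = Real.exp 5 * Real.exp 2 := by rw [← Real.exp_add]; norm_num
    have e3 := exp_five_ge
    have e4 : Real.exp 2 = Real.exp 1 ^ 2 := by rw [← Real.exp_nat_mul]; norm_num
    have e5 := Real.exp_one_gt_d9
    rw [e2, e4]
    nlinarith
  calc Real.log (40 * Real.log (2 * n))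
      ≤ Real.log (Real.exp 7 * (Real.exp 1 + Real.log (1 + X))) := by
        refine Real.log_le_log (by positivity) ?_
        calc 40 * Real.log (2 * n) ≤ 680 * (Real.exp 1 + Real.log (1 + X)) := by linarith
          _ ≤ _ := by gcongr
    _ = 7 + logFactor X := by
        rw [Real.log_mul (by positivity) (by positivity), Real.log_exp, logFactor]
    _ ≤ 8 * logFactor X := by linarith

theorem exists_calls_bound {X : ℝ} (hX : 0 < X) :
    ∃ n : ℕ, 1 ≤ n ∧ (n : ℝ) ≤ 1 + 2 ^ 23 * X * logFactor X ∧
      133334 * X * Real.log (40 * Real.log (2 * n)) ≤ n := by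
  have hl := one_le_logFactor hX.le
  have hpos : 0 < 2 ^ 23 * X * logFactor X := by positivity
  have h1 : 1 ≤ ⌈2 ^ 23 * X * logFactor X⌉₊ := Nat.ceil_pos.2 hpos
  have h2 : (⌈2 ^ 23 * X * logFactor X⌉₊ : ℝ) ≤ 1 + 2 ^ 23 * X * logFactor X := by
    have := (Nat.ceil_lt_add_one hpos.le).le
    linarith
  refine ⟨⌈2 ^ 23 * X * logFactor X⌉₊, h1, h2, ?_⟩
  have h3 := log_mul_log_le hX.le h1 h2
  calc 133334 * X * Real.log (40 * Real.log (2 * ⌈2 ^ 23 * X * logFactor X⌉₊))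
      ≤ 133334 * X * (8 * logFactor X) := by gcongr
    _ ≤ 2 ^ 23 * X * logFactor X := by
        have : 0 ≤ X * logFactor X := by positivity
        linarith
    _ ≤ _ := Nat.le_ceil _

/-! ### Regret -/

section Regret

variable {d k : ℕ} {θ h : E d} {Δ : ℝ}

theorem inner_sub_perturbedAction_le (hh : ‖h‖ = 1) (p : E d) :
    ⟪θ, h - perturbedAction h p⟫ ≤ ‖θ‖ * ‖p‖ ^ 2 + |⟪p, θ⟫| := by
  set c := 1 / √(‖p‖ ^ 2 + ‖h‖ ^ 2) with hc
  have hp := sq_nonneg ‖p‖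
  have hs1 : 1 ≤ √(‖p‖ ^ 2 + ‖h‖ ^ 2) := by
    refine Real.le_sqrt_of_sq_le ?_
    rw [hh]; linarith
  have hs2 : √(‖p‖ ^ 2 + ‖h‖ ^ 2) ≤ 1 + ‖p‖ ^ 2 := by
    refine Real.sqrt_le_iff.2 ⟨by positivity, ?_⟩
    rw [hh]; nlinarith
  have hc0 : 0 ≤ c := by positivity
  have hc1 : c ≤ 1 := by rw [hc, div_le_one (by linarith)]; exact hs1
  have hc2 : 1 - c ≤ ‖p‖ ^ 2 := by
    have : 1 / (1 + ‖p‖ ^ 2) ≤ c := one_div_le_one_div_of_le (by linarith) hs2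
    have h2 : 1 - ‖p‖ ^ 2 ≤ 1 / (1 + ‖p‖ ^ 2) := by
      rw [le_div_iff₀ (by positivity)]; nlinarith
    linarith
  have e : ⟪θ, h - perturbedAction h p⟫ = (1 - c) * ⟪θ, h⟫ - c * ⟪p, θ⟫ := by
    rw [perturbedAction, ← hc, inner_sub_right, real_inner_smul_right, inner_add_right,
      real_inner_comm p θ]
    ring
  have h1 : ⟪θ, h⟫ ≤ ‖θ‖ := by
    have := real_inner_le_norm θ h
    rwa [hh, mul_one] at this
  have h2 : (1 - c) * ⟪θ, h⟫ ≤ ‖p‖ ^ 2 * ‖θ‖ :=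
    (mul_le_mul_of_nonneg_left h1 (by linarith)).trans
      (mul_le_mul_of_nonneg_right hc2 (norm_nonneg _))
  have h3 : -(c * ⟪p, θ⟫) ≤ |⟪p, θ⟫| := by
    rw [← mul_neg]
    calc c * -⟪p, θ⟫ ≤ c * |⟪p, θ⟫| := by gcongr; exact neg_le_abs _
      _ ≤ 1 * |⟪p, θ⟫| := by gcongr
      _ = _ := one_mul _
  rw [e]
  linarith

theorem sum_norm_sq_le (hΔ : 0 < Δ) {p : Fin k → E d} (hE : ∑ i, energy θ h Δ (p i) ≤ 5 * k) :
    ∑ i, ‖p i‖ ^ 2 ≤ 40 * k * Δ ^ 2 := by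
  have h1 : ∑ i, ‖p i‖ ^ 2 / (8 * Δ ^ 2) ≤ 5 * (k : ℝ) := by
    refine (Finset.sum_le_sum fun i _ => ?_).trans hE
    have : 0 ≤ effDim h * ⟪p i, θ⟫ ^ 2 / (8 * Δ ^ 2 * ‖perp h θ‖ ^ 2) := by positivity
    unfold energy
    linarith
  rw [← Finset.sum_div, div_le_iff₀ (by positivity)] at h1
  linarith

theorem sum_abs_inner_le (hθ : perp h θ ≠ 0) (hΔ : 0 < Δ) {p : Fin k → E d}
    (hE : ∑ i, energy θ h Δ (p i) ≤ 5 * k) :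
    ∑ i, |⟪p i, θ⟫| ≤ 21 * k * (Δ * ‖perp h θ‖ / √(effDim h : ℝ)) := by
  have hd : (0 : ℝ) < effDim h := by exact_mod_cast effDim_pos hθ
  have hv : 0 < ‖perp h θ‖ := norm_pos_iff.2 hθ
  set w := Δ * ‖perp h θ‖ / √(effDim h : ℝ) with hw
  have hw0 : 0 < w := by positivity
  have hterm : ∀ i, |⟪p i, θ⟫| ≤ w * (1 / 2 + 4 * energy θ h Δ (p i)) := by
    intro i
    have h1 : ⟪p i, θ⟫ ^ 2 / w ^ 2 ≤ 8 * energy θ h Δ (p i) := by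
      have e : ⟪p i, θ⟫ ^ 2 / w ^ 2 =
          8 * (effDim h * ⟪p i, θ⟫ ^ 2 / (8 * Δ ^ 2 * ‖perp h θ‖ ^ 2)) := by
        rw [hw, div_pow, Real.sq_sqrt hd.le]
        field_simp
      have : 0 ≤ ‖p i‖ ^ 2 / (8 * Δ ^ 2) := by positivity
      rw [e, energy]
      linarith
    have h2 : |⟪p i, θ⟫| / w ≤ 1 / 2 + 1 / 2 * (⟪p i, θ⟫ ^ 2 / w ^ 2) := by
      rw [← sq_abs ⟪p i, θ⟫, ← div_pow]
      nlinarith [sq_nonneg (|⟪p i, θ⟫| / w - 1)]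
    have h3 : |⟪p i, θ⟫| / w ≤ 1 / 2 + 4 * energy θ h Δ (p i) := by linarith
    rw [div_le_iff₀ hw0] at h3
    linarith
  calc ∑ i, |⟪p i, θ⟫| ≤ ∑ i, w * (1 / 2 + 4 * energy θ h Δ (p i)) :=
        Finset.sum_le_sum fun i _ => hterm i
    _ = w * (k * (1 / 2) + 4 * ∑ i, energy θ h Δ (p i)) := by
        rw [← Finset.mul_sum, Finset.sum_add_distrib, ← Finset.mul_sum]
        simp
    _ ≤ w * (k * (1 / 2) + 4 * (5 * k)) := by gcongr
    _ ≤ 21 * k * w := by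
        have : 0 ≤ k * w := by positivity
        linarith

theorem sum_calls_inner_le (hθ : perp h θ ≠ 0) (hΔ : 0 < Δ) (hh : ‖h‖ = 1) {p : Fin k → E d}
    (hE : ∑ i, energy θ h Δ (p i) ≤ 5 * k) {c : Fin k → ℕ} {n : ℕ} (hc : ∀ i, c i ≤ n) {M : ℝ}
    (hM : 0.33 * k * n ≤ M) :
    ∑ i, (c i : ℝ) * ⟪θ, h - perturbedAction h (p i)⟫ ≤
      160 * (M * ‖θ‖ * Δ ^ 2) + 84 * (M * (Δ * ‖perp h θ‖ / √(effDim h : ℝ))) := by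
  set w := Δ * ‖perp h θ‖ / √(effDim h : ℝ) with hw
  have hw0 : 0 ≤ w := by positivity
  have hkn : (0 : ℝ) ≤ k * n := by positivity
  calc ∑ i, (c i : ℝ) * ⟪θ, h - perturbedAction h (p i)⟫
      ≤ ∑ i, (n : ℝ) * (‖θ‖ * ‖p i‖ ^ 2 + |⟪p i, θ⟫|) := by
        refine Finset.sum_le_sum fun i _ => ?_
        calc (c i : ℝ) * ⟪θ, h - perturbedAction h (p i)⟫
            ≤ c i * (‖θ‖ * ‖p i‖ ^ 2 + |⟪p i, θ⟫|) := by
              gcongr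
              exact inner_sub_perturbedAction_le hh (p i)
          _ ≤ _ := by
              gcongr
              exact hc i
    _ = n * (‖θ‖ * ∑ i, ‖p i‖ ^ 2 + ∑ i, |⟪p i, θ⟫|) := by
        rw [← Finset.mul_sum, Finset.sum_add_distrib, ← Finset.mul_sum]
    _ ≤ n * (‖θ‖ * (40 * k * Δ ^ 2) + 21 * k * w) := by
        gcongr
        · exact sum_norm_sq_le hΔ hE
        · exact sum_abs_inner_le hθ hΔ hE
    _ = k * n * (40 * (‖θ‖ * Δ ^ 2) + 21 * w) := by ring
    _ ≤ 4 * M * (40 * (‖θ‖ * Δ ^ 2) + 21 * w) :=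
        mul_le_mul_of_nonneg_right (by linarith) (by positivity)
    _ = _ := by ring

theorem norm_sq_eq_inner_sq_add (hh : ‖h‖ = 1) : ‖θ‖ ^ 2 = ⟪h, θ⟫ ^ 2 + ‖perp h θ‖ ^ 2 := by
  have h1 := Submodule.norm_sq_eq_add_norm_sq_starProjection θ (Submodule.span ℝ {h})
  rw [Submodule.starProjection_unit_singleton ℝ hh, norm_smul, hh, mul_one, Real.norm_eq_abs,
    sq_abs] at h1
  exact h1

theorem hint_regret_le (hθ : θ ≠ 0) (hh : ‖h‖ = 1) (hi : -(‖θ‖ / 4) ≤ ⟪h, θ⟫) :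
    ‖θ‖ - ⟪h, θ⟫ ≤ 4 / 3 * (‖perp h θ‖ ^ 2 / ‖θ‖) := by
  have h1 := norm_sq_eq_inner_sq_add (θ := θ) hh
  have h0 : 0 < ‖θ‖ := norm_pos_iff.2 hθ
  have h2 : ⟪h, θ⟫ ≤ ‖θ‖ := by
    have := real_inner_le_norm h θ
    rwa [hh, one_mul] at this
  rw [mul_div_assoc', le_div_iff₀ h0]
  nlinarith [mul_nonneg (sub_nonneg.2 h2) (show 0 ≤ ⟪h, θ⟫ + ‖θ‖ / 4 by linarith)]

theorem inner_unit_sub (hθ : θ ≠ 0) (a : E d) : ⟪θ, (1 / ‖θ‖) • θ - a⟫ = ‖θ‖ - ⟪a, θ⟫ := by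
  have h0 : ‖θ‖ ≠ 0 := norm_ne_zero_iff.2 hθ
  rw [inner_sub_right, real_inner_smul_right, real_inner_self_eq_norm_sq, real_inner_comm]
  field_simp

theorem norm_perturbedAction_zero_le (p : E d) : ‖perturbedAction 0 p‖ ≤ 1 := by
  have h1 : √(‖p‖ ^ 2 + ‖(0 : E d)‖ ^ 2) = ‖p‖ := by simp
  rw [perturbedAction, h1, zero_add, norm_smul, Real.norm_of_nonneg (by positivity), one_div]
  exact inv_mul_le_one

theorem perp_zero (u : E d) : perp 0 u = u := by
  refine Submodule.starProjection_eq_self_iff.2 ?_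
  rw [Submodule.span_zero_singleton, Submodule.bot_orthogonal_eq_top]
  exact Submodule.mem_top

variable {p : Fin k → E d} {ξ : Fin k × ℕ × Bool → ℝ} {s : State d k} {n : ℕ}

theorem State.sum_calls_mul (c : ℝ) :
    ∑ i, (s.calls i : ℝ) * c = s.innerCalls * c := by
  rw [← Finset.sum_mul, State.innerCalls, Nat.cast_sum]

theorem Invariant.hint_regret_le (hs : Invariant θ h Δ p ξ s n) (hθ : perp h θ ≠ 0) (hΔ : 0 < Δ)
    (hh : ‖h‖ = 1) (hE : ∑ i, energy θ h Δ (p i) ≤ 5 * k)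
    (hM : 0.33 * k * n ≤ (s.innerCalls : ℝ)) :
    s.regret θ h ≤ 168 * (s.innerCalls * ‖θ‖ * Δ ^ 2 +
      s.innerCalls * (Δ * ‖perp h θ‖ / √(d : ℝ))) := by
  have hd1 : 0 < effDim h := effDim_pos hθ
  have hd : (0 : ℝ) < effDim h := by exact_mod_cast hd1
  have hd4 : (d : ℝ) ≤ 4 * effDim h := by
    have : d ≤ 4 * effDim h := by
      unfold effDim at hd1 ⊢
      split_ifs at hd1 ⊢ <;> omega
    exact_mod_cast this
  have hd0 : (0 : ℝ) < d := hd.trans_le (by exact_mod_cast effDim_le h)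
  have hsq : √(d : ℝ) ≤ 2 * √(effDim h : ℝ) := by
    refine Real.sqrt_le_iff.2 ⟨by positivity, ?_⟩
    rw [mul_pow, Real.sq_sqrt hd.le]
    linarith
  have h1 : Δ * ‖perp h θ‖ / √(effDim h : ℝ) ≤ 2 * (Δ * ‖perp h θ‖ / √(d : ℝ)) := by
    have hs1 : 0 < √(effDim h : ℝ) := Real.sqrt_pos.2 hd
    have hs2 : 0 < √(d : ℝ) := Real.sqrt_pos.2 hd0
    rw [mul_div_assoc', div_le_div_iff₀ hs1 hs2]
    have : 0 ≤ Δ * ‖perp h θ‖ := by positivity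
    nlinarith [mul_le_mul_of_nonneg_left hsq this]
  rw [hs.regret_eq]
  simp only [sub_self, inner_zero_right, zero_add]
  refine (sum_calls_inner_le hθ hΔ hh hE hs.calls_le hM).trans ?_
  have h2 := mul_le_mul_of_nonneg_left h1 (Nat.cast_nonneg (α := ℝ) s.innerCalls)
  have h3 : 0 ≤ (s.innerCalls : ℝ) * ‖θ‖ * Δ ^ 2 := by positivity
  linarith

theorem Invariant.total_regret_le (hs : Invariant θ h Δ p ξ s n) (hθ : perp h θ ≠ 0) (hΔ : 0 < Δ)
    (hh : ‖h‖ = 1 ∨ h = 0) (hi : -(‖θ‖ / 4) ≤ ⟪h, θ⟫) (hE : ∑ i, energy θ h Δ (p i) ≤ 5 * k)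
    (hM : 0.33 * k * n ≤ (s.innerCalls : ℝ)) :
    s.regret θ ((1 / ‖θ‖) • θ) ≤ 300 * (s.innerCalls * (‖perp h θ‖ ^ 2 / ‖θ‖) +
      s.innerCalls * ‖θ‖ * Δ ^ 2) := by
  have hθ0 : θ ≠ 0 := by
    rintro rfl
    exact hθ (by simp [perp])
  have hn0 : 0 < ‖θ‖ := norm_pos_iff.2 hθ0
  have hM0 : (0 : ℝ) ≤ s.innerCalls := Nat.cast_nonneg _
  have h3 : 0 ≤ (s.innerCalls : ℝ) * ‖θ‖ * Δ ^ 2 := by positivity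
  have h4 : 0 ≤ (s.innerCalls : ℝ) * (‖perp h θ‖ ^ 2 / ‖θ‖) := by positivity
  rw [hs.regret_eq]
  rcases hh with hh | rfl
  · have hr := HintBandit.hint_regret_le hθ0 hh hi
    set r := ‖θ‖ - ⟪h, θ⟫ with hrdef
    have hsplit : ∀ i, (s.calls i : ℝ) * (⟪θ, (1 / ‖θ‖) • θ - h⟫ +
        ⟪θ, (1 / ‖θ‖) • θ - perturbedAction h (p i)⟫) =
        s.calls i * (2 * r) + s.calls i * ⟪θ, h - perturbedAction h (p i)⟫ := by
      intro i
      rw [inner_unit_sub hθ0, inner_unit_sub hθ0, inner_sub_right, real_inner_comm h θ,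
        real_inner_comm (perturbedAction h (p i)) θ, hrdef]
      ring
    rw [Finset.sum_congr rfl fun i _ => hsplit i, Finset.sum_add_distrib,
      State.sum_calls_mul]
    have h1 := sum_calls_inner_le hθ hΔ hh hE hs.calls_le hM
    have hd : (1 : ℝ) ≤ effDim h := by exact_mod_cast effDim_pos hθ
    have hw : Δ * ‖perp h θ‖ / √(effDim h : ℝ) ≤ ‖perp h θ‖ ^ 2 / ‖θ‖ + ‖θ‖ * Δ ^ 2 := by
      calc Δ * ‖perp h θ‖ / √(effDim h : ℝ) ≤ Δ * ‖perp h θ‖ :=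
            div_le_self (by positivity) (Real.one_le_sqrt.2 hd)
        _ ≤ _ := by
            rw [div_add' _ _ _ hn0.ne', le_div_iff₀ hn0]
            nlinarith [sq_nonneg (‖perp h θ‖ - ‖θ‖ * Δ), sq_nonneg (‖perp h θ‖ + ‖θ‖ * Δ)]
    have h2 := mul_le_mul_of_nonneg_left hw hM0
    have h5 := mul_le_mul_of_nonneg_left hr hM0
    linarith
  · have hterm : ∀ i, (s.calls i : ℝ) * (⟪θ, (1 / ‖θ‖) • θ - 0⟫ +
        ⟪θ, (1 / ‖θ‖) • θ - perturbedAction 0 (p i)⟫) ≤ s.calls i * (3 * ‖θ‖) := by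
      intro i
      rw [inner_unit_sub hθ0, inner_unit_sub hθ0, inner_zero_left]
      gcongr
      have h1 := neg_le_of_abs_le (abs_real_inner_le_norm (perturbedAction 0 (p i)) θ)
      have h2 := mul_le_mul_of_nonneg_right (norm_perturbedAction_zero_le (p i)) hn0.le
      linarith
    refine (Finset.sum_le_sum fun i _ => hterm i).trans ?_
    rw [State.sum_calls_mul]
    rw [perp_zero] at h4 ⊢
    have e : ‖θ‖ ^ 2 / ‖θ‖ = ‖θ‖ := by field_simp
    rw [e] at h4 ⊢
    linarith

end Regret

/-! ### The main theorem -/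

theorem innerCalls_bound {k n : ℕ} {δ X M : ℝ} (hk : (k : ℝ) ≤ 561 * max 1 (Real.log (1 / δ)))
    (hM : M ≤ k * n) (hX : 1 ≤ X) (hn : (n : ℝ) ≤ 1 + 2 ^ 23 * X * logFactor X) :
    M ≤ 5 * 10 ^ 9 * (logFactor X * max 1 (Real.log (1 / δ)) * X) := by
  have hl := one_le_logFactor (zero_le_one.trans hX)
  set L := max 1 (Real.log (1 / δ)) with hL
  have hL1 : 1 ≤ L := le_max_left _ _
  have h1 : 1 ≤ X * logFactor X := one_le_mul_of_one_le_of_one_le hX hl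
  calc M ≤ k * n := hM
    _ ≤ (561 * L) * (1 + 2 ^ 23 * X * logFactor X) := by gcongr
    _ ≤ (561 * L) * ((1 + 2 ^ 23) * (X * logFactor X)) := by
        gcongr
        linarith
    _ = 561 * (1 + 2 ^ 23) * (logFactor X * L * X) := by ring
    _ ≤ _ := mul_le_mul_of_nonneg_right (by norm_num) (by positivity)

theorem hint_regret_bound {a t v Δ S M A X : ℝ} (ha : 0 < a) (ht : 0 ≤ t) (hv : 0 < v)
    (hΔ : 0 < Δ) (hS : S ≤ 3) (hA : 0 ≤ A) (hX : X = a * S / (Δ ^ 2 * v ^ 2))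
    (hM : M ≤ 5 * 10 ^ 9 * (A * X)) :
    M * t * Δ ^ 2 + M * (Δ * v / √a) ≤
      15 * 10 ^ 9 * A * (a * t / v ^ 2 + √a / (Δ * v)) := by
  have hsa : 0 < √a := Real.sqrt_pos.2 ha
  have hsa2 : √a ^ 2 = a := Real.sq_sqrt ha.le
  generalize √a = q at hsa hsa2 ⊢
  subst hsa2
  calc M * t * Δ ^ 2 + M * (Δ * v / q) = M * (t * Δ ^ 2 + Δ * v / q) := by ring
    _ ≤ 5 * 10 ^ 9 * (A * X) * (t * Δ ^ 2 + Δ * v / q) := by gcongr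
    _ = 5 * 10 ^ 9 * A * S * (q ^ 2 * t / v ^ 2 + q / (Δ * v)) := by
        rw [hX]
        field_simp
    _ ≤ 5 * 10 ^ 9 * A * 3 * (q ^ 2 * t / v ^ 2 + q / (Δ * v)) := by gcongr
    _ = _ := by ring

theorem total_regret_bound {a t v Δ S M A X H : ℝ} (ha : 0 < a) (ht : 0 < t) (hv : 0 < v)
    (hΔ : 0 < Δ) (hS : S ≤ 3) (hA : 0 ≤ A) (hH : 0 ≤ H) (hX : X = a * S / (Δ ^ 2 * v ^ 2))
    (hM : M ≤ 5 * 10 ^ 9 * (A * X)) :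
    M * (v ^ 2 / t) + M * t * Δ ^ 2 ≤
      15 * 10 ^ 9 * A * (a * (1 + H) / (Δ ^ 2 * t) + a * (1 + H) * t / v ^ 2) := by
  calc M * (v ^ 2 / t) + M * t * Δ ^ 2 = M * (v ^ 2 / t + t * Δ ^ 2) := by ring
    _ ≤ 5 * 10 ^ 9 * (A * X) * (v ^ 2 / t + t * Δ ^ 2) := by gcongr
    _ = 5 * 10 ^ 9 * A * S * (a / (Δ ^ 2 * t) + a * t / v ^ 2) := by
        rw [hX]
        field_simp
    _ ≤ 5 * 10 ^ 9 * A * 3 * (a / (Δ ^ 2 * t) + a * t / v ^ 2) := by gcongr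
    _ ≤ 5 * 10 ^ 9 * A * 3 * (a * (1 + H) / (Δ ^ 2 * t) + a * (1 + H) * t / v ^ 2) := by
        have : a ≤ a * (1 + H) := le_mul_of_one_le_right ha.le (by linarith)
        gcongr
    _ = _ := by ring

theorem numInstances_le {δ : ℝ} (h0 : 0 < δ) (h1 : δ < 1) :
    (numInstances δ : ℝ) ≤ 561 * max 1 (Real.log (1 / δ)) := by
  have hpos : 0 < Real.log (1 / δ) := Real.log_pos (by rw [lt_div_iff₀ h0]; linarith)
  have := (Nat.ceil_lt_add_one (show 0 ≤ 560 * Real.log (1 / δ) by positivity)).le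
  have h2 := le_max_left 1 (Real.log (1 / δ))
  have h3 := le_max_right 1 (Real.log (1 / δ))
  unfold numInstances
  linarith

end HintBandit

open HintBandit in
theorem mainTheorem7 :
    ∃ C : ℝ, 0 < C ∧
      ∀ (d : ℕ) (h θ : EuclideanSpace ℝ (Fin d)) (Δ δ : ℝ),
        0 < Δ → 0 < δ → δ < 1 → perp h θ ≠ 0 →
      ∀ (Ω : Type*) [MeasurableSpace Ω] (μ : Measure Ω) [IsProbabilityMeasure μ]
        -- the perturbations of the instances and the noise of the plays
        (p : Fin (numInstances δ) → Ω → EuclideanSpace ℝ (Fin d))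
        (ξ : Fin (numInstances δ) × ℕ × Bool → Ω → ℝ),
        (∀ i, HasLaw (p i) (perturbLaw h Δ) μ) → iIndepFun p μ →
        (∀ j, HasSubgaussianMGF (ξ j) 1 μ) → iIndepFun ξ μ →
        IndepFun (fun ω i => p i ω) (fun ω j => ξ j ω) μ →
        1 - δ ≤ μ.real {ω | ∃ n : ℕ,
          FirstReturn θ h Δ (fun i => p i ω) (fun j => ξ j ω) n ∧
          let s := run θ h Δ (fun i => p i ω) (fun j => ξ j ω) n
          let r := median s.returned
          let M : ℝ := s.innerCalls
          let X := scale θ h Δ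
          let v := ‖perp h θ‖
          -- the returned value is a constant-factor approximation
          (0.06 * v ≤ r ∧ r ≤ 5 * v) ∧
          -- number of calls
          (n : ℝ) ≤ 1 + C * X * logFactor X ∧
          -- regret with respect to the hint
          (Δ ≤ 1 / 224 → ‖h‖ = 1 →
            s.regret θ h ≤ C * (M * ‖θ‖ * Δ ^ 2 + M * (Δ * v / √(d : ℝ))) ∧
            (1 ≤ X →
              M * ‖θ‖ * Δ ^ 2 + M * (Δ * v / √(d : ℝ)) ≤
                C * logFactor X * max 1 (Real.log (1 / δ)) *
                  (d * ‖θ‖ / v ^ 2 + √(d : ℝ) / (Δ * v)))) ∧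
          -- total regret
          (Δ ≤ 1 / 224 → (‖h‖ = 1 ∨ h = 0) → -(‖θ‖ / 4) ≤ ⟪h, θ⟫ →
            s.regret θ ((1 / ‖θ‖) • θ) ≤ C * (M * (v ^ 2 / ‖θ‖) + M * ‖θ‖ * Δ ^ 2) ∧
            (1 ≤ X →
              M * (v ^ 2 / ‖θ‖) + M * ‖θ‖ * Δ ^ 2 ≤
                C * logFactor X * max 1 (Real.log (1 / δ)) *
                  (d * (1 + ‖h‖) / (Δ ^ 2 * ‖θ‖) + d * (1 + ‖h‖) * ‖θ‖ / v ^ 2)))} := by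
  refine ⟨15 * 10 ^ 9, by norm_num, ?_⟩
  intro d h θ Δ δ hΔ h0 h1 hθ Ω _ μ _ p ξ hp hpi hξ hξi hpξ
  refine measureReal_typicalRun_ge hΔ h0 (add_pow_numInstances_le h0 h1) hθ hp hpi hξ hξi hpξ ?_
  rintro ω ⟨⟨B, hB, hgood⟩, hE⟩
  have hk := one_le_numInstances h0 h1
  have hv : 0 < ‖perp h θ‖ := norm_pos_iff.2 hθ
  have hd0 : (0 : ℝ) < d := by exact_mod_cast (effDim_pos hθ).trans_le (effDim_le h)
  have hsd : 0 < √(d : ℝ) := Real.sqrt_pos.2 hd0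
  have hθ0 : 0 < ‖θ‖ := by
    refine norm_pos_iff.2 ?_
    rintro rfl
    exact hθ (by simp [perp])
  have hX : 0 < scale θ h Δ := by unfold scale; positivity
  have hl := one_le_logFactor hX.le
  obtain ⟨N, hN1, hN2, hN3⟩ := exists_calls_bound hX
  obtain ⟨n, hn, hnN⟩ := exists_firstReturn (θ := θ) (h := h) (Δ := Δ) (p := fun i => p i ω)
    (ξ := fun j => ξ j ω) hk hN1 B hB fun i hi =>
      ⟨N, hN1, le_rfl, instReturns_of_le hθ hΔ (hgood i hi).1 (hgood i hi).2 hN1 hN3⟩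
  have hn2 : (n : ℝ) ≤ 1 + 2 ^ 23 * scale θ h Δ * logFactor (scale θ h Δ) :=
    le_trans (by exact_mod_cast hnN) hN2
  have hinv := hn.invariant hk
  have hM := hn.le_innerCalls hk
  have hM0 : (0 : ℝ) ≤ (run θ h Δ (fun i => p i ω) (fun j => ξ j ω) n).innerCalls :=
    Nat.cast_nonneg _
  have hbound := fun hX1 => innerCalls_bound (numInstances_le h0 h1) hinv.innerCalls_le hX1 hn2
  have hA : 0 ≤ logFactor (scale θ h Δ) * max 1 (Real.log (1 / δ)) := by positivity
  have hS : Δ ≤ 1 / 224 → ‖h‖ = 1 ∨ h = 0 → 1 + Δ ^ 2 + ‖h‖ ^ 2 ≤ 3 := by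
    intro hΔ1 hh
    have h2 : Δ ^ 2 ≤ 1 := by nlinarith
    rcases hh with hh | hh
    · rw [hh]; linarith
    · rw [hh, norm_zero]; linarith
  refine ⟨n, hn, hn.median_mem_Icc hk B hB fun i hi m hm hret =>
    instValue_mem hθ hΔ (hgood i hi).1 (hgood i hi).2 hm hret, ?_, ?_, ?_⟩
  · refine hn2.trans ?_
    have : 0 ≤ scale θ h Δ * logFactor (scale θ h Δ) := by positivity
    linarith
  · intro hΔ1 hh
    refine ⟨(hinv.hint_regret_le hθ hΔ hh hE hM).trans ?_, fun hX1 => ?_⟩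
    · gcongr
      norm_num
    · rw [mul_assoc (15 * 10 ^ 9 : ℝ) (logFactor _)]
      exact hint_regret_bound hd0 hθ0.le hv hΔ (hS hΔ1 (Or.inl hh)) hA rfl (hbound hX1)
  · intro hΔ1 hh hi
    refine ⟨(hinv.total_regret_le hθ hΔ hh hi hE hM).trans ?_, fun hX1 => ?_⟩
    · gcongr
      norm_num
    · rw [mul_assoc (15 * 10 ^ 9 : ℝ) (logFactor _)]
      exact total_regret_bound hd0 hθ0 hv hΔ (hS hΔ1 hh) hA (norm_nonneg h) rfl (hbound hX1)
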